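/- For $n\ge 1$ let $\mathbb F_n$ be the free group with free generators $g^{(n)}_1,\dots,g^{(n)}_n$, let $C^*(\mathbb F_n)$ be its full group C$^*$-algebra (the generators are regarded as unitaries in it), and let $\otimes$ be the minimal C$^*$-tensor product. For $n,m\ge 1$ let $\varphi_{n,m}:C^*(\mathbb F_{nm})\to C^*(\mathbb F_n)\otimes C^*(\mathbb F_m)$ be the unital $*$-homomorphism with $\varphi_{n,m}(g^{(nm)}_{m(i-1)+j})=g^{(n)}_i\otimes g^{(m)}_j$ $(1\le i\le n,\ 1\le j\le m)$. Let $\mathcal A=\bigoplus_{1\le n<\infty}C^*(\mathbb F_n)$ be the C$^*$-algebraic ($c_0$-)direct sum and let $\Delta_\varphi:\mathcal A\to\mathcal A\otimes\mathcal A$ be the $*$-homomorphism with $\Delta_\varphi(x)=\sum_{ml=n}\varphi_{m,l}(x)$ for $x\in C^*(\mathbb F_n)$. A pair $(A,\Delta)$ of a C$^*$-algebra $A$ and a $*$-homomorphism $\Delta:A\to A\otimes A$ is a (strictly proper) C$^*$-bialgebra if the linear span of $\{\Delta(a)(b\otimes c): a,b,c\in A\}$ is dense in $A\otimes A$ and $(\Delta\otimes\mathrm{id})\circ\Delta=(\mathrm{id}\otimes\Delta)\circ\Delta$.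 A C$^*$-bialgebra automorphism of it is a bijective, non-degenerate $*$-homomorphism $f:A\to A$ with $(f\otimes f)\circ\Delta=\Delta\circ f$. (1) For every $t\in\mathbb R$ and $n\ge1$ there is a unique $*$-automorphism $\alpha^{(n)}_t$ of $C^*(\mathbb F_n)$ with $\alpha^{(n)}_t(g^{(n)}_i)=e^{\sqrt{-1}\,t\log n}\,g^{(n)}_i$ for $i=1,\dots,n$. The direct sum $\alpha^{(*)}_t=\bigoplus_{n\ge1}\alpha^{(n)}_t$ is a C$^*$-bialgebra automorphism of the C$^*$-bialgebra $(\mathcal A,\Delta_\varphi)$, and $\alpha^{(*)}_t\circ\alpha^{(*)}_s=\alpha^{(*)}_{t+s}$ for all $s,t\in\mathbb R$. (2) For every $n\ge1$ there is a unique $*$-automorphism $\beta^{(n)}$ of $C^*(\mathbb F_n)$ with $\beta^{(n)}(g^{(n)}_i)=g^{(n)}_{n-i+1}$ for $i=1,\dots,n$. The direct sum $\beta^{(*)}=\bigoplus_{n\ge1}\beta^{(n)}$ is a C$^*$-bialgebra automorphism of $(\mathcal A,\Delta_\varphi)$, and $\beta^{(*)}\circ\beta^{(*)}=\mathrm{id}$.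 (3) $\alpha^{(*)}_t\circ\beta^{(*)}=\beta^{(*)}\circ\alpha^{(*)}_t$ for every $t\in\mathbb R$. Hence there is a group homomorphism $\Phi$ from $\mathbb R\times(\mathbb Z/2\mathbb Z)$ to the group of $*$-automorphisms of $\mathcal A$ such that every $\Phi(g)$ is a C$^*$-bialgebra automorphism of $(\mathcal A,\Delta_\varphi)$, $\Phi(t,0)=\alpha^{(*)}_t$ for all $t\in\mathbb R$, and $\Phi(0,1)=\beta^{(*)}$. -/

import Mathlib

open scoped TensorProduct ENNReal Topology
open UniformSpace

noncomputable section

universe u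

/-! ### C⋆-seminorms and C⋆-completions -/

/-- A C⋆-seminorm on a complex ⋆-algebra. -/
structure CStarSeminorm (R : Type u) [NonUnitalRing R] [StarRing R] [Module ℂ R] extends
    Seminorm ℂ R where
  mul_le' : ∀ x y, toFun (x * y) ≤ toFun x * toFun y
  star_mul_self' : ∀ x, toFun (star x * x) = toFun x * toFun x

namespace CStarSeminorm

variable {R : Type u} [NonUnitalRing R] [StarRing R] [Module ℂ R]

instance : CoeFun (CStarSeminorm R) (fun _ => R → ℝ) := ⟨fun p => p.toSeminorm⟩

theorem nonneg (p : CStarSeminorm R) (x : R) : 0 ≤ p x := apply_nonneg p.toSeminorm x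

/-- The C⋆-seminorm `x ↦ ‖π x‖` of a ⋆-homomorphism `π` into a C⋆-algebra. -/
def ofHom {T : Type*} [NonUnitalCStarAlgebra T] (π : R →⋆ₙₐ[ℂ] T) : CStarSeminorm R where
  toFun x := ‖π x‖
  map_zero' := by simp
  add_le' x y := by simpa using norm_add_le (π x) (π y)
  neg' x := by simp
  smul' c x := by simp [norm_smul]
  mul_le' x y := by simpa using norm_mul_le (π x) (π y)
  star_mul_self' x := by simpa [map_star] using CStarRing.norm_star_mul_self (x := π x)

/-- The pointwise supremum of a pointwise bounded set of C⋆-seminorms. -/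
def sup (S : Set (CStarSeminorm R)) (h : ∀ x, ∃ C, ∀ p ∈ S, p x ≤ C) : CStarSeminorm R :=
  have bdd (x : R) : BddAbove (Set.range fun p : S => p.1 x) := by
    obtain ⟨C, hC⟩ := h x
    exact ⟨C, by rintro _ ⟨p, rfl⟩; exact hC p.1 p.2⟩
  have nn (x : R) : 0 ≤ ⨆ p : S, p.1 x := Real.iSup_nonneg fun p => p.1.nonneg x
  have le (p : S) (x : R) : p.1 x ≤ ⨆ p : S, p.1 x := le_ciSup (bdd x) p
  { toFun := fun x => ⨆ p : S, p.1 x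
    map_zero' := by simp
    add_le' := fun x y => Real.iSup_le (fun p => (map_add_le_add p.1.toSeminorm x y).trans
      (add_le_add (le p x) (le p y))) (add_nonneg (nn x) (nn y))
    neg' := fun x => by simp
    smul' := fun c x => by
      simp only [map_smul_eq_mul]
      exact (Real.mul_iSup_of_nonneg (norm_nonneg c) _).symm
    mul_le' := fun x y => Real.iSup_le (fun p => (p.1.mul_le' x y).trans
      (mul_le_mul (le p x) (le p y) (p.1.nonneg y) (nn x))) (mul_nonneg (nn x) (nn y))
    star_mul_self' := fun x => by
      apply le_antisymm
      · exact Real.iSup_le (fun p => (p.1.star_mul_self' x).le.trans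
          (mul_le_mul (le p x) (le p x) (p.1.nonneg x) (nn x))) (mul_nonneg (nn x) (nn x))
      · have key : ⨆ p : S, p.1 x ≤ √(⨆ p : S, p.1 (star x * x)) :=
          Real.iSup_le (fun p => Real.le_sqrt_of_sq_le (by
            rw [sq]; exact (p.1.star_mul_self' x).symm.le.trans (le p _))) (Real.sqrt_nonneg _)
        calc _ ≤ √(⨆ p : S, p.1 (star x * x)) * √(⨆ p : S, p.1 (star x * x)) :=
              mul_le_mul key key (nn x) (Real.sqrt_nonneg _)
          _ = _ := Real.mul_self_sqrt (nn _) }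

theorem le_sup {S : Set (CStarSeminorm R)} (h : ∀ x, ∃ C, ∀ p ∈ S, p x ≤ C)
    {p : CStarSeminorm R} (hp : p ∈ S) (x : R) : p x ≤ sup S h x := by
  obtain ⟨C, hC⟩ := h x
  exact le_ciSup (f := fun p : S => p.1 x) ⟨C, by rintro _ ⟨p, rfl⟩; exact hC p.1 p.2⟩ ⟨p, hp⟩

theorem sup_le {S : Set (CStarSeminorm R)} (h : ∀ x, ∃ C, ∀ p ∈ S, p x ≤ C) {x : R} {C : ℝ}
    (hC : 0 ≤ C) (hp : ∀ p ∈ S, p x ≤ C) : sup S h x ≤ C :=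
  Real.iSup_le (fun p : S => hp p.1 p.2) hC

theorem star_le (p : CStarSeminorm R) (x : R) : p (star x) ≤ p x := by
  have h1 := (p.star_mul_self' (star x)).symm.le.trans (p.mul_le' _ _)
  simp only [star_star] at h1
  by_contra hlt
  push Not at hlt
  have h0 := p.nonneg x
  change p (star x) * p (star x) ≤ p x * p (star x) at h1
  nlinarith

/-- The ⋆-algebra `R`, seminormed by `p`. -/
def Pre (_p : CStarSeminorm R) : Type u := R

section Pre

variable (p : CStarSeminorm R)

instance : NonUnitalRing p.Pre := inferInstanceAs (NonUnitalRing R)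
instance : StarRing p.Pre := inferInstanceAs (StarRing R)
instance : Module ℂ p.Pre := inferInstanceAs (Module ℂ R)
instance [h : IsScalarTower ℂ R R] : IsScalarTower ℂ p.Pre p.Pre := h
instance [h : SMulCommClass ℂ R R] : SMulCommClass ℂ p.Pre p.Pre := h
instance [h : StarModule ℂ R] : StarModule ℂ p.Pre := h

instance : SeminormedAddCommGroup p.Pre := AddGroupSeminorm.toSeminormedAddCommGroup
  (p.toSeminorm.toAddGroupSeminorm : AddGroupSeminorm R)

instance : NonUnitalSeminormedRing p.Pre where
  __ := (inferInstance : SeminormedAddCommGroup p.Pre)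
  __ := (inferInstance : NonUnitalRing p.Pre)
  norm_mul_le := p.mul_le'

instance : NormedSpace ℂ p.Pre where
  norm_smul_le c x := (map_smul_eq_mul p.toSeminorm c x).le

/-- The ⋆-algebra `R` inside its C⋆-completion, as seminormed space. -/
def toPre : R ≃ₗ[ℂ] p.Pre := LinearEquiv.refl ℂ R

theorem norm_toPre (x : R) : ‖p.toPre x‖ = p x := rfl

end Pre

/-- The Hausdorff completion of `R` with respect to the C⋆-seminorm `p`. -/
def Compl (p : CStarSeminorm R) : Type u := Completion p.Pre


section Compl

variable (p : CStarSeminorm R)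

instance : NormedAddCommGroup p.Compl := inferInstanceAs (NormedAddCommGroup (Completion p.Pre))
instance : NormedSpace ℂ p.Compl := inferInstanceAs (NormedSpace ℂ (Completion p.Pre))
instance : CompleteSpace p.Compl := inferInstanceAs (CompleteSpace (Completion p.Pre))

/-- The canonical map from `R` to its C⋆-completion. -/
def of : R →ₗ[ℂ] p.Compl where
  toFun x := ((p.toPre x : p.Pre) : Completion p.Pre)
  map_add' x y := by rw [map_add]; exact Completion.coe_add _ _
  map_smul' c x := by rw [map_smul]; exact Completion.coe_smul _ _

theorem norm_of (x : R) : ‖p.of x‖ = p x := Completion.norm_coe (E := p.Pre) _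

theorem denseRange_of : DenseRange p.of := Completion.denseRange_coe (α := p.Pre)

theorem induction {P : p.Compl → Prop} (hc : IsClosed {x | P x}) (h : ∀ x, P (p.of x))
    (x : p.Compl) : P x := p.denseRange_of.induction_on x hc h

theorem induction₂ {P : p.Compl → p.Compl → Prop}
    (hc : IsClosed {x : p.Compl × p.Compl | P x.1 x.2})
    (h : ∀ x y, P (p.of x) (p.of y)) (x y : p.Compl) : P x y :=
  isClosed_property2 p.denseRange_of hc h x y

theorem induction₃ {P : p.Compl → p.Compl → p.Compl → Prop}
    (hc : IsClosed {x : p.Compl × p.Compl × p.Compl | P x.1 x.2.1 x.2.2})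
    (h : ∀ x y z, P (p.of x) (p.of y) (p.of z)) (x y z : p.Compl) : P x y z :=
  isClosed_property3 p.denseRange_of hc h x y z

instance : Mul p.Compl where
  mul := Function.curry ((Completion.isDenseInducing_coe.prodMap Completion.isDenseInducing_coe).extend
    (fun x : p.Pre × p.Pre => ((x.1 * x.2 : p.Pre) : Completion p.Pre)))

theorem of_mul (x y : R) : p.of (x * y) = p.of x * p.of y :=
  ((Completion.isDenseInducing_coe.prodMap Completion.isDenseInducing_coe).extend_eq
    (f := fun x : p.Pre × p.Pre => ((x.1 * x.2 : p.Pre) : Completion p.Pre))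
    ((Completion.continuous_coe p.Pre).comp continuous_mul) (p.toPre x, p.toPre y)).symm

instance : ContinuousMul p.Compl where
  continuous_mul := by
    let m := (AddMonoidHom.mul : p.Pre →+ p.Pre →+ p.Pre).compr₂ Completion.toCompl
    have : Continuous fun x : p.Pre × p.Pre => m x.1 x.2 :=
      (Completion.continuous_coe p.Pre).comp continuous_mul
    have di : IsDenseInducing (Completion.toCompl : p.Pre → Completion p.Pre) :=
      Completion.isDenseInducing_coe
    exact (di.extend_Z_bilin di this :)

theorem norm_star_toPre_le (x : p.Pre) : ‖starAddEquiv x‖ ≤ 1 * ‖x‖ := by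
  rw [one_mul]; exact p.star_le x

instance : Star p.Compl where
  star := Completion.map (starAddEquiv : p.Pre ≃+ p.Pre)

theorem of_star (x : R) : p.of (star x) = star (p.of x) :=
  (Completion.map_coe (AddMonoidHomClass.uniformContinuous_of_bound
    (starAddEquiv : p.Pre ≃+ p.Pre) 1 p.norm_star_toPre_le) (p.toPre x)).symm

instance : ContinuousStar p.Compl where
  continuous_star := Completion.continuous_map

instance : NonUnitalNormedRing p.Compl where
  __ := (inferInstance : NormedAddCommGroup p.Compl)
  __ := (inferInstance : Mul p.Compl)
  zero_mul := p.induction (isClosed_eq (by fun_prop) (by fun_prop)) fun x => by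
    rw [← map_zero p.of, ← of_mul, zero_mul]
  mul_zero := p.induction (isClosed_eq (by fun_prop) (by fun_prop)) fun x => by
    rw [← map_zero p.of, ← of_mul, mul_zero]
  mul_assoc := p.induction₃ (isClosed_eq (by fun_prop) (by fun_prop)) fun x y z => by
    simp only [← of_mul, mul_assoc]
  left_distrib := p.induction₃ (isClosed_eq (by fun_prop) (by fun_prop)) fun x y z => by
    simp only [← of_mul, ← map_add, mul_add]
  right_distrib := p.induction₃ (isClosed_eq (by fun_prop) (by fun_prop)) fun x y z => by
    simp only [← of_mul, ← map_add, add_mul]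
  norm_mul_le := p.induction₂ (isClosed_le (by fun_prop) (by fun_prop)) fun x y => by
    simpa only [← of_mul, norm_of] using! p.mul_le' x y

instance : StarRing p.Compl where
  star_involutive := p.induction (isClosed_eq (by fun_prop) (by fun_prop)) fun x => by
    simp only [← of_star, star_star]
  star_mul := p.induction₂ (isClosed_eq (by fun_prop) (by fun_prop)) fun x y => by
    simp only [← of_star, ← of_mul, star_mul]
  star_add := p.induction₂ (isClosed_eq (by fun_prop) (by fun_prop)) fun x y => by
    simp only [← of_star, ← map_add, star_add]

instance : CStarRing p.Compl where
  norm_mul_self_le := p.induction (isClosed_le (by fun_prop) (by fun_prop)) fun x => by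
    simp only [← of_star, ← of_mul, norm_of]
    exact (p.star_mul_self' x).symm.le

instance [IsScalarTower ℂ R R] [SMulCommClass ℂ R R] [StarModule ℂ R] :
    NonUnitalCStarAlgebra p.Compl where
  smul_assoc c x y := p.induction₂ (P := fun x y => (c • x) * y = c • (x * y))
    (isClosed_eq ((continuous_fst.const_smul c).mul continuous_snd)
      ((continuous_fst.mul continuous_snd).const_smul c))
    (fun x y => by rw [← map_smul, ← of_mul, ← of_mul, ← map_smul, smul_mul_assoc]) x y
  smul_comm c x y := p.induction₂ (P := fun x y => c • (x * y) = x * (c • y))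
    (isClosed_eq ((continuous_fst.mul continuous_snd).const_smul c)
      (continuous_fst.mul (continuous_snd.const_smul c)))
    (fun x y => by rw [← map_smul, ← of_mul, ← of_mul, ← map_smul, mul_smul_comm]) x y
  star_smul c := p.induction (isClosed_eq (continuous_id.const_smul c).star
      (continuous_star.const_smul (star c))) fun x => by
    rw [← map_smul, ← of_star, ← of_star, star_smul, map_smul]


/-- The canonical ⋆-homomorphism from `R` to its C⋆-completion. -/
def ofHomₙ : R →⋆ₙₐ[ℂ] p.Compl where
  toFun := p.of
  map_smul' := by simp
  map_zero' := map_zero _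
  map_add' := map_add _
  map_mul' := p.of_mul
  map_star' := p.of_star

/-- A ⋆-homomorphism into a C⋆-algebra that is dominated by `p` extends to the C⋆-completion. -/
def lift {T : Type*} [NonUnitalCStarAlgebra T] (π : R →⋆ₙₐ[ℂ] T) (h : ∀ x, ‖π x‖ ≤ p x) :
    p.Compl →⋆ₙₐ[ℂ] T :=
  let f : p.Pre →L[ℂ] T := LinearMap.mkContinuous
    { toFun := fun x => π x, map_add' := map_add π, map_smul' := map_smul π } 1
    (fun x => by rw [one_mul]; exact h x)
  let g : p.Compl →L[ℂ] T := f.fromCompletion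
  have hg (x : R) : g (p.of x) = π x := f.fromCompletion_apply_coe (p.toPre x)
  { toFun := g
    map_smul' := fun c x => by simp
    map_zero' := by simp
    map_add' := fun x y => by simp
    map_mul' := p.induction₂ (isClosed_eq (by fun_prop) (by fun_prop)) fun x y => by
      rw [← of_mul, hg, hg, hg, map_mul]
    map_star' := p.induction (isClosed_eq (by fun_prop) (by fun_prop)) fun x => by
      rw [← of_star, hg, hg, map_star] }

theorem lift_of {T : Type*} [NonUnitalCStarAlgebra T] (π : R →⋆ₙₐ[ℂ] T) (h : ∀ x, ‖π x‖ ≤ p x)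
    (x : R) : p.lift π h (p.of x) = π x :=
  ContinuousLinearMap.fromCompletion_apply_coe (α := p.Pre) _ (p.toPre x)

end Compl

end CStarSeminorm

/-! ### The full group C⋆-algebra -/

section Group

variable {G : Type u} [Group G]

/-- The involution `∑ c_g g ↦ ∑ conj(c_g) g⁻¹` of the complex group algebra. -/
instance MonoidAlgebra.instStarGroup : Star (MonoidAlgebra ℂ G) where
  star x := .ofCoeff ((x.coeff.mapRange star (star_zero ℂ)).equivMapDomain (Equiv.inv G))

theorem MonoidAlgebra.star_single (g : G) (c : ℂ) :
    star (MonoidAlgebra.single g c) = MonoidAlgebra.single g⁻¹ (star c) := by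
  apply MonoidAlgebra.coeff_injective
  change ((Finsupp.single g c).mapRange star (star_zero ℂ)).equivMapDomain (Equiv.inv G) =
    Finsupp.single g⁻¹ (star c)
  rw [Finsupp.mapRange_single, Finsupp.equivMapDomain_single]; rfl

instance MonoidAlgebra.instStarRingGroup : StarRing (MonoidAlgebra ℂ G) :=
  have add (x y : MonoidAlgebra ℂ G) : star (x + y) = star x + star y := by
    apply MonoidAlgebra.coeff_injective
    ext g
    change star (x.coeff g⁻¹ + y.coeff g⁻¹) = star (x.coeff g⁻¹) + star (y.coeff g⁻¹)
    exact star_add _ _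
  have zero : star (0 : MonoidAlgebra ℂ G) = 0 := by
    apply MonoidAlgebra.coeff_injective
    ext g
    exact star_zero ℂ
  { star_add := add
    star_involutive := fun x => by
      induction x using MonoidAlgebra.induction_linear with
      | zero => rw [zero, zero]
      | add x y hx hy => rw [add, add, hx, hy]
      | single g c => rw [star_single, star_single, inv_inv, star_star]
    star_mul := fun x y => by
      induction x using MonoidAlgebra.induction_linear with
      | zero => rw [zero_mul, zero, mul_zero]
      | add x x' hx hx' => rw [add_mul, add, add, hx, hx', mul_add]
      | single g c =>
        induction y using MonoidAlgebra.induction_linear with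
        | zero => rw [mul_zero, zero, zero_mul]
        | add y y' hy hy' => rw [mul_add, add, add, hy, hy', add_mul]
        | single g' c' =>
          simp only [MonoidAlgebra.single_mul_single, star_single, mul_inv_rev, star_mul] }

instance MonoidAlgebra.instStarModuleGroup : StarModule ℂ (MonoidAlgebra ℂ G) where
  star_smul c x := by
    apply MonoidAlgebra.coeff_injective
    ext g
    change star (c * x.coeff g⁻¹) = star c * star (x.coeff g⁻¹)
    rw [star_mul, mul_comm]

theorem MonoidAlgebra.bounded_cstarSeminorm (x : MonoidAlgebra ℂ G) :
    ∃ C, ∀ p : CStarSeminorm (MonoidAlgebra ℂ G), p x ≤ C := by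
  induction x using MonoidAlgebra.induction_on with
  | of g =>
    refine ⟨1, fun p => ?_⟩
    have h1 := p.star_mul_self' (1 : MonoidAlgebra ℂ G)
    have h2 := p.star_mul_self' (MonoidAlgebra.of ℂ G g)
    have h3 : star (MonoidAlgebra.of ℂ G g) * MonoidAlgebra.of ℂ G g = 1 := by
      simp [MonoidAlgebra.star_single, MonoidAlgebra.one_def]
    rw [h3] at h2
    rw [star_one, one_mul] at h1
    change p 1 = p 1 * p 1 at h1
    change p 1 = p (MonoidAlgebra.of ℂ G g) * p (MonoidAlgebra.of ℂ G g) at h2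
    have h4 : p 1 ≤ 1 := by nlinarith [p.nonneg 1, sq_nonneg (p 1 - 1)]
    nlinarith [p.nonneg (MonoidAlgebra.of ℂ G g)]
  | add x y hx hy =>
    obtain ⟨C, hC⟩ := hx
    obtain ⟨D, hD⟩ := hy
    exact ⟨C + D, fun p => (map_add_le_add p.toSeminorm x y).trans (add_le_add (hC p) (hD p))⟩
  | smul c x hx =>
    obtain ⟨C, hC⟩ := hx
    exact ⟨‖c‖ * C, fun p => (map_smul_eq_mul p.toSeminorm c x).le.trans
      (mul_le_mul_of_nonneg_left (hC p) (norm_nonneg c))⟩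

variable (G) in
/-- The maximal C⋆-norm of the group algebra: `‖x‖ = sup ‖π x‖` over all ⋆-homomorphisms `π` of
`ℂ[G]` into C⋆-algebras. -/
def groupCStarSeminorm : CStarSeminorm (MonoidAlgebra ℂ G) :=
  .sup {p | ∃ (T : Type u) (_ : NonUnitalCStarAlgebra T) (π : MonoidAlgebra ℂ G →⋆ₙₐ[ℂ] T),
      p = .ofHom π} fun x =>
    (MonoidAlgebra.bounded_cstarSeminorm x).imp fun _ h p _ => h p

variable (G) in
/-- The full group C⋆-algebra `C*(G)` of a discrete group. -/
def GroupCStar : Type u := (groupCStarSeminorm G).Compl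

instance : NonUnitalCStarAlgebra (GroupCStar G) :=
  inferInstanceAs (NonUnitalCStarAlgebra (groupCStarSeminorm G).Compl)

namespace GroupCStar

variable (G) in
/-- The canonical ⋆-homomorphism from the group algebra to `C*(G)`. -/
def ofAlg : MonoidAlgebra ℂ G →⋆ₙₐ[ℂ] GroupCStar G := (groupCStarSeminorm G).ofHomₙ

/-- The canonical image of a group element in `C*(G)`. -/
def u (g : G) : GroupCStar G := ofAlg G (MonoidAlgebra.of ℂ G g)

theorem u_mul (g h : G) : u (g * h) = u g * u h := by
  rw [u, map_mul, map_mul]; rfl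

theorem u_inv (g : G) : u g⁻¹ = star (u g) := by
  rw [u, u, ← map_star]
  congr 1
  simp [MonoidAlgebra.star_single]

section lift

variable {T : Type u} [NonUnitalCStarAlgebra T] (v : G → T)
  (hmul : ∀ g h, v (g * h) = v g * v h) (hinv : ∀ g, v g⁻¹ = star (v g))

theorem liftMagma_single (g : G) (c : ℂ) :
    MonoidAlgebra.liftMagma ℂ (⟨v, hmul⟩ : G →ₙ* T) (MonoidAlgebra.single g c) = c • v g := by
  simp [MonoidAlgebra.liftMagma]

/-- The ⋆-homomorphism `∑ c_g g ↦ ∑ c_g v(g)` on the group algebra. -/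
def liftAlg : MonoidAlgebra ℂ G →⋆ₙₐ[ℂ] T where
  __ := MonoidAlgebra.liftMagma ℂ (⟨v, hmul⟩ : G →ₙ* T)
  map_star' x := by
    change MonoidAlgebra.liftMagma ℂ (⟨v, hmul⟩ : G →ₙ* T) (star x) =
      star (MonoidAlgebra.liftMagma ℂ (⟨v, hmul⟩ : G →ₙ* T) x)
    induction x using MonoidAlgebra.induction_linear with
    | zero => simp
    | add x y hx hy => simp only [star_add, map_add, hx, hy]
    | single g c =>
      rw [MonoidAlgebra.star_single, liftMagma_single, liftMagma_single, star_smul, hinv]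

theorem norm_liftAlg_le (x : MonoidAlgebra ℂ G) :
    ‖liftAlg v hmul hinv x‖ ≤ groupCStarSeminorm G x := by
  refine CStarSeminorm.le_sup (p := .ofHom (liftAlg v hmul hinv)) _ ?_ x
  exact ⟨T, _, liftAlg v hmul hinv, rfl⟩

/-- The ⋆-homomorphism `u g ↦ v g` on `C*(G)`. -/
def lift : GroupCStar G →⋆ₙₐ[ℂ] T :=
  (groupCStarSeminorm G).lift (liftAlg v hmul hinv) (norm_liftAlg_le v hmul hinv)

theorem lift_u (g : G) : lift v hmul hinv (u g) = v g :=
  (CStarSeminorm.lift_of _ _ _ _).trans ((liftMagma_single v hmul g 1).trans (one_smul ℂ _))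

end lift

end GroupCStar

end Group

/-! ### The minimal tensor product -/

open TensorProduct in
/-- The Hilbert space tensor product. -/
abbrev HilbertTensor (H K : Type u) [NormedAddCommGroup H] [InnerProductSpace ℂ H]
    [NormedAddCommGroup K] [InnerProductSpace ℂ K] : Type u := Completion (H ⊗[ℂ] K)

section MinTensor

section Rep

variable {H K : Type u} [NormedAddCommGroup H] [InnerProductSpace ℂ H]
  [NormedAddCommGroup K] [InnerProductSpace ℂ K]

/-- The bounded operator `S ⊗ T` on the Hilbert space tensor product. -/
def opTensor (S : H →L[ℂ] H) (T : K →L[ℂ] K) : HilbertTensor H K →L[ℂ] HilbertTensor H K :=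
  (TensorProduct.mapL S T).completion

/-- The elementary tensor `x ⊗ y` in the Hilbert space tensor product. -/
def hilbertTmul (x : H) (y : K) : HilbertTensor H K := ((x ⊗ₜ y : H ⊗[ℂ] K) : HilbertTensor H K)

theorem opTensor_coe (S : H →L[ℂ] H) (T : K →L[ℂ] K) (x : H ⊗[ℂ] K) :
    opTensor S T (x : HilbertTensor H K) = (TensorProduct.mapL S T x : H ⊗[ℂ] K) :=
  ContinuousLinearMap.completion_apply_coe _ _

theorem hilbertTensor_ext {S T : HilbertTensor H K →L[ℂ] HilbertTensor H K}
    (h : ∀ x : H ⊗[ℂ] K, S x = T x) : S = T := by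
  ext x
  induction x using Completion.induction_on with
  | hp => exact isClosed_eq S.continuous T.continuous
  | ih x => exact h x

theorem opTensor_mul (S S' : H →L[ℂ] H) (T T' : K →L[ℂ] K) :
    opTensor (S * S') (T * T') = opTensor S T * opTensor S' T' :=
  hilbertTensor_ext fun x => by
    rw [mul_apply_eq_comp, opTensor_coe, opTensor_coe, opTensor_coe,
      TensorProduct.mapL_mul]; rfl

variable [CompleteSpace H] [CompleteSpace K]

theorem opTensor_star (S : H →L[ℂ] H) (T : K →L[ℂ] K) :
    opTensor (star S) (star T) = star (opTensor S T) := by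
  refine (ContinuousLinearMap.eq_adjoint_iff _ _).mpr fun x y => ?_
  induction x, y using Completion.induction_on₂ with
  | hp => apply isClosed_eq <;> fun_prop
  | ih x y =>
    rw [opTensor_coe, opTensor_coe, Completion.inner_coe, Completion.inner_coe]
    induction x using TensorProduct.induction_on with
    | zero => simp
    | add x x' hx hx' => simp only [map_add, inner_add_left, hx, hx']
    | tmul a b =>
      induction y using TensorProduct.induction_on with
      | zero => simp
      | add y y' hy hy' => simp only [map_add, inner_add_right, hy, hy']
      | tmul a' b' =>
        simp only [TensorProduct.mapL_tmul, TensorProduct.inner_tmul,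
          ContinuousLinearMap.star_eq_adjoint, ContinuousLinearMap.adjoint_inner_left]

variable {A B : Type u} [NonUnitalCStarAlgebra A] [NonUnitalCStarAlgebra B]

/-- The representation `π ⊗ ρ` of the algebraic tensor product on `H ⊗ K`. -/
def tensorRep (π : A →⋆ₙₐ[ℂ] (H →L[ℂ] H)) (ρ : B →⋆ₙₐ[ℂ] (K →L[ℂ] K)) :
    A ⊗[ℂ] B →⋆ₙₐ[ℂ] (HilbertTensor H K →L[ℂ] HilbertTensor H K) :=
  let f : A ⊗[ℂ] B →ₗ[ℂ] (HilbertTensor H K →L[ℂ] HilbertTensor H K) :=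
    TensorProduct.lift (LinearMap.mk₂ ℂ (fun a b => opTensor (π a) (ρ b))
      (fun a a' b => hilbertTensor_ext fun x => by
        rw [add_apply, opTensor_coe, opTensor_coe, opTensor_coe, map_add,
          TensorProduct.mapL_add_left, ← Completion.coe_add]; rfl)
      (fun c a b => hilbertTensor_ext fun x => by
        rw [smul_apply, opTensor_coe, opTensor_coe, map_smul,
          TensorProduct.mapL_smul_left, ← Completion.coe_smul]; rfl)
      (fun a b b' => hilbertTensor_ext fun x => by
        rw [add_apply, opTensor_coe, opTensor_coe, opTensor_coe, map_add,
          TensorProduct.mapL_add_right, ← Completion.coe_add]; rfl)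
      (fun c a b => hilbertTensor_ext fun x => by
        rw [smul_apply, opTensor_coe, opTensor_coe, map_smul,
          TensorProduct.mapL_smul_right, ← Completion.coe_smul]; rfl))
  { toFun := f
    map_smul' := fun c x => map_smul f c x
    map_zero' := map_zero f
    map_add' := map_add f
    map_mul' := fun x y => by
      induction x using TensorProduct.induction_on with
      | zero => simp
      | add x x' hx hx' => simp only [add_mul, map_add, hx, hx']
      | tmul a b =>
        induction y using TensorProduct.induction_on with
        | zero => simp
        | add y y' hy hy' => simp only [mul_add, map_add, hy, hy']
        | tmul a' b' => simp [f, opTensor_mul]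
    map_star' := fun x => by
      induction x using TensorProduct.induction_on with
      | zero => rw [star_zero, map_zero]; exact (star_zero (HilbertTensor H K →L[ℂ] HilbertTensor H K)).symm
      | add x x' hx hx' => rw [star_add, map_add, map_add, hx, hx']; exact (star_add (f x) (f x')).symm
      | tmul a b => simp [f, opTensor_star, map_star] }

theorem tensorRep_tmul (π : A →⋆ₙₐ[ℂ] (H →L[ℂ] H)) (ρ : B →⋆ₙₐ[ℂ] (K →L[ℂ] K)) (a : A) (b : B) :
    tensorRep π ρ (a ⊗ₜ b) = opTensor (π a) (ρ b) := rfl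

end Rep

variable (A B : Type u) [NonUnitalCStarAlgebra A] [NonUnitalCStarAlgebra B]

/-- The C⋆-seminorms `x ↦ ‖(π ⊗ ρ) x‖` for representations `π` of `A` and `ρ` of `B`. -/
def spatialSeminorms : Set (CStarSeminorm (A ⊗[ℂ] B)) :=
  {p | ∃ (H K : Type u) (_ : NormedAddCommGroup H) (_ : InnerProductSpace ℂ H)
      (_ : CompleteSpace H) (_ : NormedAddCommGroup K) (_ : InnerProductSpace ℂ K)
      (_ : CompleteSpace K) (π : A →⋆ₙₐ[ℂ] (H →L[ℂ] H)) (ρ : B →⋆ₙₐ[ℂ] (K →L[ℂ] K)),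
      p = .ofHom (T := HilbertTensor H K →L[ℂ] HilbertTensor H K) (tensorRep π ρ)}

theorem spatialSeminorms_bounded (x : A ⊗[ℂ] B) : ∃ C, ∀ p ∈ spatialSeminorms A B, p x ≤ C := by
  induction x using TensorProduct.induction_on with
  | zero => exact ⟨0, fun p _ => (map_zero p.toSeminorm).le⟩
  | add x y hx hy =>
    obtain ⟨C, hC⟩ := hx
    obtain ⟨D, hD⟩ := hy
    exact ⟨C + D, fun p h =>
      (map_add_le_add p.toSeminorm x y).trans (add_le_add (hC p h) (hD p h))⟩
  | tmul a b =>
    refine ⟨‖a‖ * ‖b‖, ?_⟩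
    rintro _ ⟨H, K, _, _, _, _, _, _, π, ρ, rfl⟩
    change ‖opTensor (π a) (ρ b)‖ ≤ _
    have h1 : ‖opTensor (π a) (ρ b)‖ ≤ ‖π a‖ * ‖ρ b‖ := by
      refine ContinuousLinearMap.opNorm_le_bound _ (by positivity) fun x => ?_
      induction x using Completion.induction_on with
      | hp => apply isClosed_le <;> fun_prop
      | ih x =>
        rw [opTensor_coe, Completion.norm_coe, Completion.norm_coe]
        exact ((TensorProduct.mapL (π a) (ρ b)).le_opNorm x).trans
          (mul_le_mul_of_nonneg_right (TensorProduct.norm_mapL_le _ _) (norm_nonneg x))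
    exact h1.trans (mul_le_mul (NonUnitalStarAlgHom.norm_apply_le π a)
      (NonUnitalStarAlgHom.norm_apply_le ρ b) (norm_nonneg _) (norm_nonneg _))

/-- The minimal (spatial) C⋆-norm `‖x‖ = sup ‖(π ⊗ ρ) x‖` on the algebraic tensor product, the
supremum being over all representations `π` of `A` and `ρ` of `B` on Hilbert spaces. -/
def minSeminorm : CStarSeminorm (A ⊗[ℂ] B) :=
  .sup (spatialSeminorms A B) (spatialSeminorms_bounded A B)

/-- The minimal C⋆-tensor product of two C⋆-algebras. -/
def MinTensor : Type u := (minSeminorm A B).Compl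

instance : NonUnitalCStarAlgebra (MinTensor A B) :=
  inferInstanceAs (NonUnitalCStarAlgebra (minSeminorm A B).Compl)

namespace MinTensor

/-- The canonical ⋆-homomorphism from the algebraic to the minimal tensor product. -/
def ofAlg : A ⊗[ℂ] B →⋆ₙₐ[ℂ] MinTensor A B := (minSeminorm A B).ofHomₙ

variable {A B}

theorem norm_ofAlg (x : A ⊗[ℂ] B) : ‖ofAlg A B x‖ = minSeminorm A B x :=
  (minSeminorm A B).norm_of x

theorem induction {P : MinTensor A B → Prop} (hc : IsClosed {x | P x})
    (h : ∀ x, P (ofAlg A B x)) (x : MinTensor A B) : P x :=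
  (minSeminorm A B).induction hc h x

/-- The elementary tensor `a ⊗ b`. -/
def tmul (a : A) (b : B) : MinTensor A B := ofAlg A B (a ⊗ₜ b)

theorem tmul_mul_tmul (a a' : A) (b b' : B) :
    tmul a b * tmul a' b' = tmul (a * a') (b * b') := by
  rw [tmul, tmul, ← map_mul, Algebra.TensorProduct.tmul_mul_tmul]; rfl

theorem star_tmul (a : A) (b : B) : star (tmul a b) = tmul (star a) (star b) := by
  rw [tmul, ← map_star, TensorProduct.star_tmul]; rfl

theorem zero_tmul (b : B) : tmul (0 : A) b = 0 := by
  rw [tmul, TensorProduct.zero_tmul, map_zero]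

theorem tmul_zero (a : A) : tmul a (0 : B) = 0 := by
  rw [tmul, TensorProduct.tmul_zero, map_zero]

section rep

variable {H K : Type u} [NormedAddCommGroup H] [InnerProductSpace ℂ H] [CompleteSpace H]
  [NormedAddCommGroup K] [InnerProductSpace ℂ K] [CompleteSpace K]

theorem ofHom_tensorRep_mem (π : A →⋆ₙₐ[ℂ] (H →L[ℂ] H)) (ρ : B →⋆ₙₐ[ℂ] (K →L[ℂ] K)) :
    .ofHom (T := HilbertTensor H K →L[ℂ] HilbertTensor H K) (tensorRep π ρ) ∈
      spatialSeminorms A B :=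
  ⟨H, K, inferInstance, inferInstance, inferInstance, inferInstance, inferInstance,
    inferInstance, π, ρ, rfl⟩

theorem norm_tensorRep_le (π : A →⋆ₙₐ[ℂ] (H →L[ℂ] H)) (ρ : B →⋆ₙₐ[ℂ] (K →L[ℂ] K))
    (x : A ⊗[ℂ] B) : ‖tensorRep π ρ x‖ ≤ minSeminorm A B x :=
  CStarSeminorm.le_sup (spatialSeminorms_bounded A B) (ofHom_tensorRep_mem π ρ) x

/-- The representation `π ⊗ ρ` of the minimal tensor product. -/
def rep (π : A →⋆ₙₐ[ℂ] (H →L[ℂ] H)) (ρ : B →⋆ₙₐ[ℂ] (K →L[ℂ] K)) :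
    MinTensor A B →⋆ₙₐ[ℂ] (HilbertTensor H K →L[ℂ] HilbertTensor H K) :=
  (minSeminorm A B).lift (T := HilbertTensor H K →L[ℂ] HilbertTensor H K)
    (tensorRep π ρ) (norm_tensorRep_le π ρ)

theorem rep_tmul (π : A →⋆ₙₐ[ℂ] (H →L[ℂ] H)) (ρ : B →⋆ₙₐ[ℂ] (K →L[ℂ] K)) (a : A) (b : B) :
    rep π ρ (tmul a b) = opTensor (π a) (ρ b) :=
  CStarSeminorm.lift_of (T := HilbertTensor H K →L[ℂ] HilbertTensor H K) _ _ _ _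

end rep

section map

variable {A' B' : Type u} [NonUnitalCStarAlgebra A'] [NonUnitalCStarAlgebra B']
  (f : A →⋆ₙₐ[ℂ] A') (g : B →⋆ₙₐ[ℂ] B')

/-- The ⋆-homomorphism `f ⊗ g` of algebraic tensor products. -/
def mapAlg : A ⊗[ℂ] B →⋆ₙₐ[ℂ] A' ⊗[ℂ] B' :=
  let F : A ⊗[ℂ] B →ₗ[ℂ] A' ⊗[ℂ] B' :=
    TensorProduct.map (LinearMapClass.linearMap f) (LinearMapClass.linearMap g)
  { toFun := F
    map_smul' := fun c x => map_smul F c x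
    map_zero' := map_zero F
    map_add' := map_add F
    map_mul' := fun x y => by
      induction x using TensorProduct.induction_on with
      | zero => simp
      | add x x' hx hx' => simp only [add_mul, map_add, hx, hx']
      | tmul a b =>
        induction y using TensorProduct.induction_on with
        | zero => simp
        | add y y' hy hy' => simp only [mul_add, map_add, hy, hy']
        | tmul a' b' => simp [F]
    map_star' := fun x => by
      induction x using TensorProduct.induction_on with
      | zero => simp
      | add x x' hx hx' => simp only [star_add, map_add, hx, hx']
      | tmul a b => simp [F, map_star] }

theorem minSeminorm_mapAlg_le (x : A ⊗[ℂ] B) :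
    minSeminorm A' B' (mapAlg f g x) ≤ minSeminorm A B x := by
  refine CStarSeminorm.sup_le _ ((minSeminorm A B).nonneg x) ?_
  rintro _ ⟨H, K, _, _, _, _, _, _, π, ρ, rfl⟩
  refine le_of_eq_of_le ?_ (norm_tensorRep_le (π.comp f) (ρ.comp g) x)
  change ‖tensorRep π ρ (mapAlg f g x)‖ = _
  congr 1
  induction x using TensorProduct.induction_on with
  | zero => simp
  | add x x' hx hx' => simp only [map_add, hx, hx']
  | tmul a b => rfl

/-- The ⋆-homomorphism `f ⊗ g` of minimal tensor products. -/
def map : MinTensor A B →⋆ₙₐ[ℂ] MinTensor A' B' :=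
  (minSeminorm A B).lift ((ofAlg A' B').comp (mapAlg f g)) fun x =>
    (norm_ofAlg _).le.trans (minSeminorm_mapAlg_le f g x)

theorem map_tmul (a : A) (b : B) : map f g (tmul a b) = tmul (f a) (g b) :=
  CStarSeminorm.lift_of _ _ _ _

end map

end MinTensor

end MinTensor

/-! ### C⋆-bialgebras -/

section Bialgebra

variable {A : Type u} [NonUnitalCStarAlgebra A]

/-- `u ∈ (A ⊗ A) ⊗ A` and `v ∈ A ⊗ (A ⊗ A)` are the same element of `A ⊗ A ⊗ A`: for all
representations `π₁, π₂, π₃` of `A` on Hilbert spaces `H₁, H₂, H₃`, the operators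
`((π₁ ⊗ π₂) ⊗ π₃) u` and `(π₁ ⊗ (π₂ ⊗ π₃)) v` have the same matrix coefficients under the
identification `(H₁ ⊗ H₂) ⊗ H₃ = H₁ ⊗ (H₂ ⊗ H₃)`. -/
def MinTensor.AssocEq (u : MinTensor (MinTensor A A) A) (v : MinTensor A (MinTensor A A)) : Prop :=
  ∀ (H₁ H₂ H₃ : Type u)
    [NormedAddCommGroup H₁] [InnerProductSpace ℂ H₁] [CompleteSpace H₁]
    [NormedAddCommGroup H₂] [InnerProductSpace ℂ H₂] [CompleteSpace H₂]
    [NormedAddCommGroup H₃] [InnerProductSpace ℂ H₃] [CompleteSpace H₃]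
    (π₁ : A →⋆ₙₐ[ℂ] (H₁ →L[ℂ] H₁)) (π₂ : A →⋆ₙₐ[ℂ] (H₂ →L[ℂ] H₂))
    (π₃ : A →⋆ₙₐ[ℂ] (H₃ →L[ℂ] H₃)) (x₁ y₁ : H₁) (x₂ y₂ : H₂) (x₃ y₃ : H₃),
    inner ℂ (hilbertTmul (hilbertTmul x₁ x₂) x₃)
        (rep (rep π₁ π₂) π₃ u (hilbertTmul (hilbertTmul y₁ y₂) y₃)) =
      inner ℂ (hilbertTmul x₁ (hilbertTmul x₂ x₃))
        (rep π₁ (rep π₂ π₃) v (hilbertTmul y₁ (hilbertTmul y₂ y₃)))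

/-- `(A, Δ)` is a (strictly proper) C⋆-bialgebra: the linear span of `{Δ(a)(b ⊗ c)}` is dense
in `A ⊗ A`, and `(Δ ⊗ id) ∘ Δ = (id ⊗ Δ) ∘ Δ`. -/
structure IsCStarBialgebra (Δ : A →⋆ₙₐ[ℂ] MinTensor A A) : Prop where
  dense : closure (Submodule.span ℂ {x | ∃ a b c : A, x = Δ a * MinTensor.tmul b c} :
    Set (MinTensor A A)) = Set.univ
  coassoc : ∀ a, MinTensor.AssocEq (MinTensor.map Δ (NonUnitalStarAlgHom.id ℂ A) (Δ a))
    (MinTensor.map (NonUnitalStarAlgHom.id ℂ A) Δ (Δ a))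

/-- `f` is a C⋆-bialgebra automorphism of `(A, Δ)`: a bijective non-degenerate ⋆-homomorphism of
`A` onto itself with `(f ⊗ f) ∘ Δ = Δ ∘ f`. -/
structure IsCStarBialgebraAut (Δ : A →⋆ₙₐ[ℂ] MinTensor A A) (f : A →⋆ₙₐ[ℂ] A) : Prop where
  isCStarBialgebra : IsCStarBialgebra Δ
  bijective : Function.Bijective f
  nondegenerate : closure (Submodule.span ℂ {x | ∃ a b : A, x = f a * b} : Set A) = Set.univ
  map_comul : (MinTensor.map f f).comp Δ = Δ.comp f

end Bialgebra

/-! ### The `c₀`-direct sum of C⋆-algebras -/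

section C0Sum

variable {ι : Type u} (A : ι → Type u) [∀ i, NonUnitalCStarAlgebra (A i)]

/-- The C⋆-algebraic direct sum `⨁ A i`: the families with `‖x i‖ → 0`, with sup norm. -/
def c0Sum : NonUnitalStarSubalgebra ℂ (lp A ∞) where
  carrier := {x | Filter.Tendsto (fun i => ‖x i‖) Filter.cofinite (𝓝 0)}
  zero_mem' := by simpa using! tendsto_const_nhds
  add_mem' {x y} hx hy := by
    refine squeeze_zero (fun _ => norm_nonneg _) (fun i => ?_) (by simpa using Filter.Tendsto.add hx hy)
    exact norm_add_le (x i) (y i)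
  mul_mem' {x y} hx hy := by
    refine squeeze_zero (fun _ => norm_nonneg _) (fun i => ?_) (by simpa using Filter.Tendsto.mul hx hy)
    exact norm_mul_le (x i) (y i)
  smul_mem' c x hx := by
    refine squeeze_zero (fun _ => norm_nonneg _) (fun i => ?_) (by simpa using Filter.Tendsto.const_mul ‖c‖ hx)
    exact norm_smul_le c (x i)
  star_mem' {x} hx := by
    simpa [Filter.Tendsto] using hx


instance isClosed_c0Sum : IsClosed (c0Sum A : Set (lp A ∞)) := by
  refine isClosed_of_closure_subset fun x hx => ?_
  change Filter.Tendsto (fun i => ‖x i‖) Filter.cofinite (𝓝 0)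
  rw [Metric.mem_closure_iff] at hx
  rw [Metric.tendsto_nhds]
  intro ε hε
  obtain ⟨y, hy, hxy⟩ := hx (ε / 2) (half_pos hε)
  have hy' : Filter.Tendsto (fun i => ‖y i‖) Filter.cofinite (𝓝 0) := hy
  filter_upwards [Metric.tendsto_nhds.mp hy' (ε / 2) (half_pos hε)] with i hi
  rw [dist_zero_right, norm_norm] at hi ⊢
  have h1 : ‖x i - y i‖ ≤ ‖x - y‖ := lp.norm_apply_le_norm ENNReal.top_ne_zero (x - y) i
  rw [dist_eq_norm] at hxy
  have h2 := norm_add_le (x i - y i) (y i)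
  rw [sub_add_cancel] at h2
  linarith

/-- The C⋆-algebraic direct sum, as a C⋆-algebra. -/
def C0Sum : Type u := c0Sum A

instance : NonUnitalCStarAlgebra (C0Sum A) := inferInstanceAs (NonUnitalCStarAlgebra (c0Sum A))

variable {A}

namespace C0Sum

theorem tendsto (x : C0Sum A) : Filter.Tendsto (fun i => ‖x.1 i‖) Filter.cofinite (𝓝 0) := x.2

theorem norm_apply_le (x : C0Sum A) (i : ι) : ‖x.1 i‖ ≤ ‖x‖ :=
  lp.norm_apply_le_norm ENNReal.top_ne_zero x.1 i

/-- The element of the direct sum with the given components. -/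
def mk (x : ∀ i, A i) (h : Filter.Tendsto (fun i => ‖x i‖) Filter.cofinite (𝓝 0)) : C0Sum A :=
  ⟨⟨x, memℓp_infty h.bddAbove_range_of_cofinite⟩, h⟩

theorem ext {x y : C0Sum A} (h : ∀ i, x.1 i = y.1 i) : x = y :=
  Subtype.ext (Subtype.ext (funext h))

theorem norm_le {x : C0Sum A} {C : ℝ} (hC : 0 ≤ C) (h : ∀ i, ‖x.1 i‖ ≤ C) : ‖x‖ ≤ C :=
  lp.norm_le_of_forall_le hC h

/-- The projection of the direct sum onto a summand. -/
def proj (i : ι) : C0Sum A →⋆ₙₐ[ℂ] A i where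
  toFun x := x.1 i
  map_smul' _ _ := rfl
  map_zero' := rfl
  map_add' _ _ := rfl
  map_mul' _ _ := rfl
  map_star' _ := rfl

/-- The direct sum `⨁ f i` of ⋆-homomorphisms. -/
def map {B : ι → Type u} [∀ i, NonUnitalCStarAlgebra (B i)] (f : ∀ i, A i →⋆ₙₐ[ℂ] B i) :
    C0Sum A →⋆ₙₐ[ℂ] C0Sum B where
  toFun x := mk (fun i => f i (x.1 i)) (squeeze_zero (fun _ => norm_nonneg _)
    (fun i => NonUnitalStarAlgHom.norm_apply_le (f i) (x.1 i)) x.tendsto)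
  map_smul' c x := ext fun i => map_smul (f i) c (x.1 i)
  map_zero' := ext fun i => map_zero (f i)
  map_add' x y := ext fun i => map_add (f i) (x.1 i) (y.1 i)
  map_mul' x y := ext fun i => map_mul (f i) (x.1 i) (y.1 i)
  map_star' x := ext fun i => map_star (f i) (x.1 i)

variable [DecidableEq ι]

/-- The inclusion of a summand into the direct sum. -/
def single (i : ι) : A i →⋆ₙₐ[ℂ] C0Sum A where
  toFun a := mk (Pi.single i a) <| by
    refine tendsto_const_nhds.congr' ?_
    filter_upwards [(Set.finite_singleton i).compl_mem_cofinite] with j hj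
    rw [Pi.single_eq_of_ne hj, norm_zero]
  map_smul' c a := ext fun j => congrFun (Pi.single_smul i c a) j
  map_zero' := ext fun j => congrFun (Pi.single_zero i) j
  map_add' a b := ext fun j => congrFun (Pi.single_add i a b) j
  map_mul' a b := ext fun j => congrFun (Pi.single_mul i a b) j
  map_star' a := ext fun j => congrFun (Pi.single_star i a) j

theorem single_mul_single {i j : ι} (h : i ≠ j) (a : A i) (b : A j) :
    single i a * single j b = 0 := ext fun k => by
  change (Pi.single i a : ∀ i, A i) k * (Pi.single j b : ∀ i, A i) k = 0
  by_cases hk : k = i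
  · subst hk
    rw [Pi.single_eq_of_ne h b, mul_zero]
  · rw [Pi.single_eq_of_ne hk a, zero_mul]

end C0Sum

end C0Sum

/-! ### Sums of pairwise orthogonal ⋆-homomorphisms -/

section OrthogonalSum

variable {κ A T : Type*} [NonUnitalCStarAlgebra A] [NonUnitalCStarAlgebra T]

/-- A finite sum of pairwise orthogonal ⋆-homomorphisms. -/
def orthoFinsetSum (ψ : κ → A →⋆ₙₐ[ℂ] T) (horth : ∀ q r, q ≠ r → ∀ x y, ψ q x * ψ r y = 0)
    (s : Finset κ) : A →⋆ₙₐ[ℂ] T where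
  toFun x := ∑ q ∈ s, ψ q x
  map_smul' c x := by simp [Finset.smul_sum]
  map_zero' := by simp
  map_add' x y := by simp [Finset.sum_add_distrib]
  map_mul' x y := by
    rw [Finset.sum_mul_sum]
    refine Finset.sum_congr rfl fun q hq => ?_
    rw [Finset.sum_eq_single_of_mem q hq fun r _ hr => horth q r hr.symm x y, map_mul]
  map_star' x := by simp [map_star]

/-- The pointwise sum of a family of pairwise orthogonal ⋆-homomorphisms. -/
def orthoSum (ψ : κ → A →⋆ₙₐ[ℂ] T) (horth : ∀ q r, q ≠ r → ∀ x y, ψ q x * ψ r y = 0)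
    (hsum : ∀ x, Summable fun q => ψ q x) : A →⋆ₙₐ[ℂ] T where
  toFun x := ∑' q, ψ q x
  map_smul' c x := by simpa using (hsum x).tsum_const_smul c
  map_zero' := by simp
  map_add' x y := by simpa using (hsum x).tsum_add (hsum y)
  map_mul' x y := by
    refine tendsto_nhds_unique (f := fun s : Finset κ => ∑ q ∈ s, ψ q (x * y))
      (hsum (x * y)).hasSum ?_
    refine Filter.Tendsto.congr (fun s => (map_mul (orthoFinsetSum ψ horth s) x y).symm) ?_
    exact Filter.Tendsto.mul (hsum x).hasSum (hsum y).hasSum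
  map_star' x := by simpa [map_star] using (tsum_star (f := fun q => ψ q x)).symm

end OrthogonalSum

/-! ### The comultiplication of a system of ⋆-homomorphisms over the monoid `ℕ+` -/

section Comul

variable {A : ℕ+ → Type} [∀ n, NonUnitalCStarAlgebra (A n)]
  (φ : ∀ m l : ℕ+, A (m * l) →⋆ₙₐ[ℂ] MinTensor (A m) (A l))

/-- The map `x ↦ φ_{m,l}(x_{ml}) ∈ A m ⊗ A l ⊆ (⨁ A n) ⊗ (⨁ A n)`. -/
def comulTerm (q : ℕ+ × ℕ+) : C0Sum A →⋆ₙₐ[ℂ] MinTensor (C0Sum A) (C0Sum A) :=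
  (MinTensor.map (C0Sum.single q.1) (C0Sum.single q.2)).comp
    ((φ q.1 q.2).comp (C0Sum.proj (q.1 * q.2)))

theorem map_single_mul_map_single {m l m' l' : ℕ+} (h : (m, l) ≠ (m', l'))
    (x : MinTensor (A m) (A l)) (y : MinTensor (A m') (A l')) :
    MinTensor.map (C0Sum.single (A := A) m) (C0Sum.single (A := A) l) x *
      MinTensor.map (C0Sum.single (A := A) m') (C0Sum.single (A := A) l') y = 0 := by
  have c1 : Continuous (MinTensor.map (C0Sum.single (A := A) m) (C0Sum.single (A := A) l)) :=
    NonUnitalStarAlgHom.instContinuousLinearMapClassComplex.map_continuous _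
  have c2 : Continuous (MinTensor.map (C0Sum.single (A := A) m') (C0Sum.single (A := A) l')) :=
    NonUnitalStarAlgHom.instContinuousLinearMapClassComplex.map_continuous _
  refine MinTensor.induction (P := fun x => MinTensor.map (C0Sum.single (A := A) m)
    (C0Sum.single (A := A) l) x * MinTensor.map (C0Sum.single (A := A) m')
      (C0Sum.single (A := A) l') y = 0)
    (isClosed_eq (c1.mul continuous_const) continuous_const) (fun x => ?_) x
  refine MinTensor.induction (P := fun y => MinTensor.map (C0Sum.single (A := A) m)
    (C0Sum.single (A := A) l) (MinTensor.ofAlg _ _ x) * MinTensor.map (C0Sum.single (A := A) m')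
      (C0Sum.single (A := A) l') y = 0)
    (isClosed_eq (continuous_const.mul c2) continuous_const) (fun y => ?_) y
  induction x using TensorProduct.induction_on with
  | zero => rw [map_zero, map_zero, zero_mul]
  | add x x' hx hx' => rw [map_add, map_add, add_mul, hx, hx', add_zero]
  | tmul a b =>
    induction y using TensorProduct.induction_on with
    | zero => rw [map_zero, map_zero, mul_zero]
    | add y y' hy hy' => rw [map_add, map_add, mul_add, hy, hy', add_zero]
    | tmul a' b' =>
      change MinTensor.map _ _ (MinTensor.tmul a b) * MinTensor.map _ _ (MinTensor.tmul a' b') = 0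
      rw [MinTensor.map_tmul, MinTensor.map_tmul, MinTensor.tmul_mul_tmul]
      by_cases hm : m = m'
      · have hl : l ≠ l' := fun hl => h (by rw [hm, hl])
        rw [C0Sum.single_mul_single hl, MinTensor.tmul_zero]
      · rw [C0Sum.single_mul_single hm, MinTensor.zero_tmul]

theorem comulTerm_orthogonal (q r : ℕ+ × ℕ+) (h : q ≠ r) (x y : C0Sum A) :
    comulTerm φ q x * comulTerm φ r y = 0 :=
  map_single_mul_map_single h _ _

theorem comulTerm_summable (x : C0Sum A) : Summable fun q => comulTerm φ q x := by
  rw [summable_iff_vanishing_norm]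
  intro ε hε
  have hfin : {n | ¬ ‖x.1 n‖ < ε / 2}.Finite := by
    simpa using (Metric.tendsto_nhds.mp x.tendsto (ε / 2) (half_pos hε))
  obtain ⟨M, hM⟩ := hfin.bddAbove
  refine ⟨Finset.Icc 1 M ×ˢ Finset.Icc 1 M, fun t ht => ?_⟩
  let y : C0Sum A := C0Sum.mk (fun n => if ‖x.1 n‖ < ε / 2 then x.1 n else 0)
    (squeeze_zero (fun _ => norm_nonneg _) (fun n => by
      split_ifs
      · exact le_rfl
      · simp) x.tendsto)
  have hy : ‖y‖ ≤ ε / 2 := C0Sum.norm_le (half_pos hε).le fun n => by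
    change ‖if ‖x.1 n‖ < ε / 2 then x.1 n else 0‖ ≤ ε / 2
    split_ifs with h
    · exact h.le
    · rw [norm_zero]; exact (half_pos hε).le
  have hxy : ∑ q ∈ t, comulTerm φ q x = ∑ q ∈ t, comulTerm φ q y := by
    refine Finset.sum_congr rfl fun q hq => ?_
    have hq' : ‖x.1 (q.1 * q.2)‖ < ε / 2 := by
      by_contra hcon
      have hle : q.1 * q.2 ≤ M := hM hcon
      refine Finset.disjoint_left.mp ht hq ?_
      rw [Finset.mem_product, Finset.mem_Icc, Finset.mem_Icc]
      exact ⟨⟨one_le, (le_mul_of_one_le_right' one_le).trans hle⟩,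
        ⟨one_le, (le_mul_of_one_le_left' one_le).trans hle⟩⟩
    change MinTensor.map _ _ (φ q.1 q.2 (x.1 (q.1 * q.2))) =
      MinTensor.map _ _ (φ q.1 q.2 (y.1 (q.1 * q.2)))
    have : y.1 (q.1 * q.2) = x.1 (q.1 * q.2) := if_pos hq'
    rw [this]
  rw [hxy]
  exact (NonUnitalStarAlgHom.norm_apply_le (orthoFinsetSum _ (comulTerm_orthogonal φ) t) y).trans_lt
    (hy.trans_lt (half_lt_self hε))

/-- The comultiplication `Δ_φ` of `⨁ A n`, given by `Δ_φ(x) = ∑_{ml = n} φ_{m,l}(x)` for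
`x ∈ A n`. -/
def comul : C0Sum A →⋆ₙₐ[ℂ] MinTensor (C0Sum A) (C0Sum A) :=
  orthoSum (comulTerm φ) (comulTerm_orthogonal φ) (comulTerm_summable φ)

end Comul

/-! ### Free groups -/

/-- The full group C⋆-algebra `C*(𝔽_n)` of the free group of rank `n`. -/
abbrev CF (n : ℕ) : Type := GroupCStar (FreeGroup (Fin n))

/-- The free generators `g_i^{(n)}` in `C*(𝔽_n)`, with `i` running over `0, …, n - 1`. -/
def gen (n : ℕ) (i : Fin n) : CF n := GroupCStar.u (FreeGroup.of i)

/-- The group homomorphism `𝔽_{nm} → 𝔽_n × 𝔽_m` with `g_{mi+j} ↦ (g_i, g_j)` for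
`0 ≤ i < n` and `0 ≤ j < m`. -/
def phiGroup (n m : ℕ) :
    FreeGroup (Fin (n * m)) →* FreeGroup (Fin n) × FreeGroup (Fin m) :=
  FreeGroup.lift fun k =>
    (FreeGroup.of (finProdFinEquiv.symm k).1, FreeGroup.of (finProdFinEquiv.symm k).2)

/-- The ⋆-homomorphism `φ_{n,m} : C*(𝔽_{nm}) → C*(𝔽_n) ⊗ C*(𝔽_m)` with
`g_{mi+j} ↦ g_i ⊗ g_j`. -/
def phi (n m : ℕ) : CF (n * m) →⋆ₙₐ[ℂ] MinTensor (CF n) (CF m) :=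
  GroupCStar.lift
    (fun g => MinTensor.tmul (GroupCStar.u (phiGroup n m g).1) (GroupCStar.u (phiGroup n m g).2))
    (fun g h => by
      rw [map_mul, Prod.fst_mul, Prod.snd_mul, GroupCStar.u_mul, GroupCStar.u_mul,
        MinTensor.tmul_mul_tmul])
    (fun g => by
      rw [map_inv, Prod.fst_inv, Prod.snd_inv, GroupCStar.u_inv, GroupCStar.u_inv,
        MinTensor.star_tmul])

/-- The C⋆-algebra `𝒜 = ⨁_{1 ≤ n < ∞} C*(𝔽_n)`. -/
abbrev FreeSum : Type := C0Sum fun n : ℕ+ => CF n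

/-- The comultiplication `Δ_φ` of `𝒜`. -/
def deltaPhi : FreeSum →⋆ₙₐ[ℂ] MinTensor FreeSum FreeSum :=
  comul (A := fun n : ℕ+ => CF n) fun m l => phi m l

/-- The character `g_i ↦ e^{√-1 t log n}` of `𝔽_n`. -/
def alphaChar (t : ℝ) (n : ℕ) : FreeGroup (Fin n) →* Circle :=
  FreeGroup.lift fun _ => Circle.exp (t * Real.log n)

/-- The ⋆-endomorphism `α_t^{(n)}` of `C*(𝔽_n)` with `g_i ↦ e^{√-1 t log n} g_i`. -/
def alphaN (t : ℝ) (n : ℕ) : CF n →⋆ₙₐ[ℂ] CF n :=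
  GroupCStar.lift (fun g => (alphaChar t n g : ℂ) • GroupCStar.u g)
    (fun g h => by
      rw [map_mul, Circle.coe_mul, GroupCStar.u_mul, smul_mul_smul_comm])
    (fun g => by
      rw [map_inv, Circle.coe_inv_eq_conj, GroupCStar.u_inv, star_smul]; rfl)

/-- `α_t^{(*)} = ⨁_n α_t^{(n)}`. -/
def alpha (t : ℝ) : FreeSum →⋆ₙₐ[ℂ] FreeSum :=
  C0Sum.map fun n : ℕ+ => alphaN t n

/-- The ⋆-endomorphism `β^{(n)}` of `C*(𝔽_n)` with `g_i ↦ g_{n-i+1}` in the numbering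
`g_1, …, g_n` of the generators. -/
def betaN (n : ℕ) : CF n →⋆ₙₐ[ℂ] CF n :=
  GroupCStar.lift (fun g => GroupCStar.u (FreeGroup.map Fin.rev g))
    (fun g h => by rw [map_mul, GroupCStar.u_mul])
    (fun g => by rw [map_inv, GroupCStar.u_inv])

/-- `β^{(*)} = ⨁_n β^{(n)}`. -/
def beta : FreeSum →⋆ₙₐ[ℂ] FreeSum :=
  C0Sum.map fun n : ℕ+ => betaN n

end

noncomputable section

universe u

/-! ### Density and continuity -/

/-! Every assertion is checked on free generators. ⋆-homomorphisms between C⋆-algebras are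
continuous, the span of the `u g` is dense in `C*(𝔽_n)`, the span of the elementary tensors is dense
in a minimal tensor product, and finite sums of elements of the summands are dense in `𝒜`. So two
⋆-homomorphisms out of `C*(𝔽_n)`, `n ≥ 1`, agree once they agree on the generators (`CF.hom_ext`).

A direct sum of endomorphisms `f n` commutes with `Δ_φ` as soon as `(f m ⊗ f l) ∘ φ_{m,l} = φ_{m,l}
∘ f (ml)` (`map_comul_of_intertwines`). For `α_t` this is `log (ml) = log m + log l`: the phases of
the two tensor legs multiply to the phase at `ml`. For `β` it says that reversing an index `il + j`
reverses its quotient and its remainder (`Fin.divNat_rev`). The group laws are additivity of the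
exponent and involutivity of the reversal, and they also supply the inverses needed for bijectivity.

That `(𝒜, Δ_φ)` is a C⋆-bialgebra is part of the claim. Density: if `e` is the unit of `C*(𝔽_{ml})`,
then `Δ_φ(e)(b ⊗ c) = b ⊗ c` for `b ∈ C*(𝔽_m)` and `c ∈ C*(𝔽_l)`, because only the `(m,
l)`-component of `Δ_φ(e)` meets `b ⊗ c` (`deltaPhi_mul_tmul_incl`). Coassociativity: on a group
element of `𝔽_n`, both iterated comultiplications are sums over the factorisations `n = abc`, and
their terms match because the mixed-radix digits of an index do not depend on the order in which
they are split off (`phiGroup_phiGroup_left`, `phiGroup_phiGroup_right`). -/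

theorem NonUnitalStarAlgHom.continuous_of_cstar {A B : Type*} [NonUnitalCStarAlgebra A]
    [NonUnitalCStarAlgebra B] (f : A →⋆ₙₐ[ℂ] B) : Continuous f :=
  NonUnitalStarAlgHom.instContinuousLinearMapClassComplex.map_continuous f

namespace GroupCStar

variable {G : Type u} [Group G]

theorem induction {P : GroupCStar G → Prop} (hc : IsClosed {x | P x})
    (add : ∀ x y, P x → P y → P (x + y)) (smul : ∀ (c : ℂ) x, P x → P (c • x))
    (u : ∀ g, P (u g)) (x : GroupCStar G) : P x := by
  refine (groupCStarSeminorm G).induction (P := P) hc (fun x => ?_) x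
  change P (ofAlg G x)
  induction x using MonoidAlgebra.induction_on with
  | of g => exact u g
  | add x y hx hy => rw [map_add]; exact add _ _ hx hy
  | smul c x hx => rw [map_smul]; exact smul _ _ hx

theorem hom_ext {T : Type*} [NonUnitalCStarAlgebra T] {f g : GroupCStar G →⋆ₙₐ[ℂ] T}
    (h : ∀ a, f (u a) = g (u a)) : f = g := by
  ext x
  refine induction (P := fun x => f x = g x)
    (isClosed_eq f.continuous_of_cstar g.continuous_of_cstar) (fun x y hx hy => ?_)
    (fun c x hx => ?_) h x
  · rw [map_add, map_add, hx, hy]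
  · rw [map_smul, map_smul, hx]

theorem u_one_mul (x : GroupCStar G) : u 1 * x = x := by
  refine induction (P := fun x => u 1 * x = x)
    (isClosed_eq (continuous_const.mul continuous_id) continuous_id) (fun x y hx hy => ?_)
    (fun c x hx => ?_) (fun g => ?_) x
  · rw [mul_add, hx, hy]
  · rw [mul_smul_comm, hx]
  · rw [← u_mul, one_mul]

end GroupCStar

/-! ### Elementary tensors in the minimal tensor product -/

namespace MinTensor

variable {A B : Type u} [NonUnitalCStarAlgebra A] [NonUnitalCStarAlgebra B]

theorem add_tmul (a a' : A) (b : B) : tmul (a + a') b = tmul a b + tmul a' b := by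
  rw [tmul, TensorProduct.add_tmul, map_add]; rfl

theorem tmul_add (a : A) (b b' : B) : tmul a (b + b') = tmul a b + tmul a b' := by
  rw [tmul, TensorProduct.tmul_add, map_add]; rfl

theorem smul_tmul (c : ℂ) (a : A) (b : B) : tmul (c • a) b = c • tmul a b := by
  rw [tmul, ← TensorProduct.smul_tmul', map_smul]; rfl

theorem tmul_smul (c : ℂ) (a : A) (b : B) : tmul a (c • b) = c • tmul a b := by
  rw [tmul, TensorProduct.tmul_smul, map_smul]; rfl

/-- Sums of elementary tensors suffice, without a separate scalar case, since a scalar can be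
absorbed into one leg. -/
theorem induction_tmul {P : MinTensor A B → Prop} (hc : IsClosed {x | P x})
    (add : ∀ x y, P x → P y → P (x + y)) (tmul : ∀ a b, P (tmul a b)) (x : MinTensor A B) :
    P x := by
  refine induction hc (fun x => ?_) x
  induction x using TensorProduct.induction_on with
  | zero =>
    have h := tmul 0 0
    rwa [zero_tmul] at h
  | add x y hx hy => rw [map_add]; exact add _ _ hx hy
  | tmul a b => exact tmul a b

theorem hom_ext {T : Type*} [NonUnitalCStarAlgebra T] {f g : MinTensor A B →⋆ₙₐ[ℂ] T}
    (h : ∀ a b, f (tmul a b) = g (tmul a b)) : f = g := by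
  ext x
  refine induction_tmul (P := fun x => f x = g x)
    (isClosed_eq f.continuous_of_cstar g.continuous_of_cstar) (fun x y hx hy => ?_) h x
  rw [map_add, map_add, hx, hy]

theorem map_map {A' B' A'' B'' : Type u} [NonUnitalCStarAlgebra A'] [NonUnitalCStarAlgebra B']
    [NonUnitalCStarAlgebra A''] [NonUnitalCStarAlgebra B''] (f : A →⋆ₙₐ[ℂ] A')
    (g : B →⋆ₙₐ[ℂ] B') (f' : A' →⋆ₙₐ[ℂ] A'') (g' : B' →⋆ₙₐ[ℂ] B'') (x : MinTensor A B) :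
    map f' g' (map f g x) = map (f'.comp f) (g'.comp g) x := by
  have h : (map f' g').comp (map f g) = map (f'.comp f) (g'.comp g) := hom_ext fun a b => by
    rw [NonUnitalStarAlgHom.comp_apply, map_tmul, map_tmul, map_tmul]; rfl
  exact DFunLike.congr_fun h x

theorem norm_opTensor_le {H K : Type u} [NormedAddCommGroup H] [InnerProductSpace ℂ H]
    [NormedAddCommGroup K] [InnerProductSpace ℂ K] (S : H →L[ℂ] H) (T : K →L[ℂ] K) :
    ‖opTensor S T‖ ≤ ‖S‖ * ‖T‖ := by
  refine ContinuousLinearMap.opNorm_le_bound _ (by positivity) fun x => ?_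
  induction x using Completion.induction_on with
  | hp => apply isClosed_le <;> fun_prop
  | ih x =>
    rw [opTensor_coe, Completion.norm_coe, Completion.norm_coe]
    exact ((TensorProduct.mapL S T).le_opNorm x).trans
      (mul_le_mul_of_nonneg_right (TensorProduct.norm_mapL_le _ _) (norm_nonneg x))

/-- Representations are contractive, so each spatial seminorm obeys this bound. Its purpose is the
separate continuity of `tmul`, which lets density arguments treat one leg at a time. -/
theorem norm_tmul_le (a : A) (b : B) : ‖tmul a b‖ ≤ ‖a‖ * ‖b‖ := by
  rw [tmul, norm_ofAlg]
  refine CStarSeminorm.sup_le _ (by positivity) ?_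
  rintro _ ⟨H, K, _, _, _, _, _, _, π, ρ, rfl⟩
  change ‖opTensor (π a) (ρ b)‖ ≤ _
  exact (norm_opTensor_le _ _).trans (mul_le_mul (NonUnitalStarAlgHom.norm_apply_le π a)
      (NonUnitalStarAlgHom.norm_apply_le ρ b) (norm_nonneg _) (norm_nonneg _))

theorem continuous_tmul_left (b : B) : Continuous fun a : A => tmul a b := by
  let f : A →ₗ[ℂ] MinTensor A B :=
    { toFun := fun a => tmul a b
      map_add' := fun a a' => add_tmul a a' b
      map_smul' := fun c a => smul_tmul c a b }
  exact (f.mkContinuous ‖b‖ fun a => (norm_tmul_le a b).trans_eq (mul_comm _ _)).continuous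

theorem continuous_tmul_right (a : A) : Continuous fun b : B => tmul a b := by
  let f : B →ₗ[ℂ] MinTensor A B :=
    { toFun := fun b => tmul a b
      map_add' := fun b b' => tmul_add a b b'
      map_smul' := fun c b => tmul_smul c a b }
  exact (f.mkContinuous ‖a‖ fun b => norm_tmul_le a b).continuous

end MinTensor

/-! ### Finite sums of components in the direct sum -/

namespace C0Sum

variable {ι : Type u} {A : ι → Type u} [∀ i, NonUnitalCStarAlgebra (A i)] [DecidableEq ι]

theorem single_apply_same (i : ι) (a : A i) : (single i a).1 i = a :=
  Pi.single_eq_same i a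

theorem single_apply_of_ne {i j : ι} (h : j ≠ i) (a : A i) : (single i a).1 j = 0 :=
  Pi.single_eq_of_ne h a

/-- The error of a partial sum is the restriction of `x` to the remaining indices, and its sup norm
tends to zero by the `c₀` condition. -/
theorem hasSum_single (x : C0Sum A) : HasSum (fun i => single i (x.1 i)) x := by
  have key (s : Finset ι) (j : ι) :
      (∑ i ∈ s, single i (x.1 i) : C0Sum A).1 j = if j ∈ s then x.1 j else 0 := by
    change proj j (∑ i ∈ s, single i (x.1 i)) = _
    rw [map_sum]
    split_ifs with hj
    · rw [Finset.sum_eq_single_of_mem j hj fun i _ hi => single_apply_of_ne hi.symm _]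
      exact single_apply_same j _
    · exact Finset.sum_eq_zero fun i hi =>
        single_apply_of_ne (fun h : j = i => hj (by rwa [h])) _
  refine Metric.tendsto_atTop.mpr fun ε hε => ?_
  have hfin : {n | ¬ ‖x.1 n‖ < ε / 2}.Finite := by
    simpa using (Metric.tendsto_nhds.mp x.tendsto (ε / 2) (half_pos hε))
  -- All components of norm at least `ε / 2` lie in this finite set, so any larger `s` leaves an
  -- error of norm at most `ε / 2 < ε`.
  refine ⟨hfin.toFinset, fun s hs => ?_⟩
  rw [dist_eq_norm]
  refine (norm_le (half_pos hε).le fun j => ?_).trans_lt (half_lt_self hε)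
  change ‖(∑ i ∈ s, single i (x.1 i) : C0Sum A).1 j - x.1 j‖ ≤ ε / 2
  rw [key]
  split_ifs with hj
  · rw [sub_self, norm_zero]; exact (half_pos hε).le
  · rw [zero_sub, norm_neg]
    by_contra hcon
    exact hj (hs (hfin.mem_toFinset.mpr fun h => hcon h.le))

theorem induction {P : C0Sum A → Prop} (hc : IsClosed {x | P x}) (zero : P 0)
    (add : ∀ x y, P x → P y → P (x + y)) (single : ∀ i a, P (single i a)) (x : C0Sum A) :
    P x :=
  hc.mem_of_tendsto (hasSum_single x) (Filter.Eventually.of_forall fun _ =>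
    Finset.sum_induction _ P add zero fun i _ => single i _)

theorem map_single {B : ι → Type u} [∀ i, NonUnitalCStarAlgebra (B i)]
    (f : ∀ i, A i →⋆ₙₐ[ℂ] B i) (i : ι) (a : A i) : map f (single i a) = single i (f i a) := by
  refine ext fun j => ?_
  change f j ((single i a).1 j) = _
  by_cases h : j = i
  · subst h; rw [single_apply_same, single_apply_same]
  · rw [single_apply_of_ne h, single_apply_of_ne h, map_zero]

end C0Sum

/-! ### The comultiplication on summands -/

section Comul

variable {A : ℕ+ → Type} [∀ n, NonUnitalCStarAlgebra (A n)]
  (φ : ∀ m l : ℕ+, A (m * l) →⋆ₙₐ[ℂ] MinTensor (A m) (A l))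

theorem comul_hasSum (x : C0Sum A) : HasSum (fun q => comulTerm φ q x) (comul φ x) :=
  (comulTerm_summable φ x).hasSum

theorem comulTerm_apply (q : ℕ+ × ℕ+) (x : C0Sum A) : comulTerm φ q x =
    MinTensor.map (C0Sum.single q.1) (C0Sum.single q.2) (φ q.1 q.2 (x.1 (q.1 * q.2))) := rfl

theorem comulTerm_single_of_ne {q : ℕ+ × ℕ+} {n : ℕ+} (h : q.1 * q.2 ≠ n) (a : A n) :
    comulTerm φ q (C0Sum.single n a) = 0 := by
  rw [comulTerm_apply, C0Sum.single_apply_of_ne h, map_zero, map_zero]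

theorem comulTerm_single (m l : ℕ+) (a : A (m * l)) :
    comulTerm φ (m, l) (C0Sum.single (m * l) a) =
      MinTensor.map (C0Sum.single m) (C0Sum.single l) (φ m l a) := by
  rw [comulTerm_apply, C0Sum.single_apply_same]

/-- On a summand the series is finite, as a contributing pair consists of divisors of `n`. Leaving
`s` free allows one common index set for `n` and for all its divisors when `Δ_φ` is iterated. -/
theorem comul_single {n : ℕ+} {s : Finset ℕ+} (hs : ∀ d, d ∣ n → d ∈ s) (a : A n) :
    comul φ (C0Sum.single n a) = ∑ q ∈ s ×ˢ s, comulTerm φ q (C0Sum.single n a) := by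
  refine (comul_hasSum φ _).unique (hasSum_sum_of_ne_finset_zero fun q hq => ?_)
  refine comulTerm_single_of_ne φ (fun h => hq ?_) a
  exact Finset.mem_product.mpr ⟨hs _ ⟨_, h.symm⟩, hs _ (h ▸ Dvd.intro_left _ rfl)⟩

/-- A direct sum of ⋆-endomorphisms that intertwine the system `φ` intertwines the
comultiplication. -/
theorem map_comul_of_intertwines (f : ∀ n, A n →⋆ₙₐ[ℂ] A n)
    (h : ∀ m l, (MinTensor.map (f m) (f l)).comp (φ m l) = (φ m l).comp (f (m * l))) :
    (MinTensor.map (C0Sum.map f) (C0Sum.map f)).comp (comul φ) =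
      (comul φ).comp (C0Sum.map f) := by
  ext x
  change MinTensor.map _ _ (comul φ x) = comul φ (C0Sum.map f x)
  -- A continuous additive map may be applied to the series termwise, so the two series need only be
  -- compared term by term.
  refine ((comul_hasSum φ x).map _ (NonUnitalStarAlgHom.continuous_of_cstar
    (MinTensor.map (C0Sum.map f) (C0Sum.map f)))).unique ?_
  convert comul_hasSum φ (C0Sum.map f x) using 2 with q
  have hs (n : ℕ+) : (C0Sum.map f).comp (C0Sum.single n) = (C0Sum.single n).comp (f n) := by
    ext a; exact C0Sum.map_single f n a
  change MinTensor.map _ _ (MinTensor.map _ _ (φ q.1 q.2 (x.1 (q.1 * q.2)))) =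
    MinTensor.map _ _ (φ q.1 q.2 (f _ (x.1 (q.1 * q.2))))
  rw [MinTensor.map_map, hs, hs, ← MinTensor.map_map]
  exact congrArg _ (DFunLike.congr_fun (h q.1 q.2) _)

end Comul

/-! ### The comultiplication `Δ_φ` on the summands -/

/-- The system `φ_{m,l}`, indexed by positive integers. -/
def phiPNat (m l : ℕ+) : CF (m * l : ℕ+) →⋆ₙₐ[ℂ] MinTensor (CF m) (CF l) := phi m l

/-- The inclusion of `C*(𝔽_n)` into `𝒜`. -/
def incl (n : ℕ+) : CF n →⋆ₙₐ[ℂ] FreeSum := C0Sum.single (A := fun n : ℕ+ => CF n) n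

/-- The component of `Δ_φ` with values in `C*(𝔽_m) ⊗ C*(𝔽_l)`, where `q = (m, l)`. -/
def deltaTerm (q : ℕ+ × ℕ+) : FreeSum →⋆ₙₐ[ℂ] MinTensor FreeSum FreeSum :=
  comulTerm (A := fun n : ℕ+ => CF n) phiPNat q

theorem FreeSum.induction {P : FreeSum → Prop} (hc : IsClosed {x | P x}) (zero : P 0)
    (add : ∀ x y, P x → P y → P (x + y)) (incl : ∀ n a, P (incl n a)) (x : FreeSum) : P x :=
  C0Sum.induction hc zero add incl x

theorem phiPNat_u (m l : ℕ+) (g : FreeGroup (Fin (m * l : ℕ+))) :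
    phiPNat m l (GroupCStar.u g) =
      MinTensor.tmul (GroupCStar.u (phiGroup m l g).1) (GroupCStar.u (phiGroup m l g).2) :=
  GroupCStar.lift_u _ _ _ g

theorem deltaPhi_hasSum (x : FreeSum) : HasSum (fun q => deltaTerm q x) (deltaPhi x) :=
  comul_hasSum (A := fun n : ℕ+ => CF n) phiPNat x

theorem deltaPhi_incl {n : ℕ+} {s : Finset ℕ+} (hs : ∀ d, d ∣ n → d ∈ s) (a : CF n) :
    deltaPhi (incl n a) = ∑ q ∈ s ×ˢ s, deltaTerm q (incl n a) :=
  comul_single (A := fun n : ℕ+ => CF n) phiPNat hs a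

theorem deltaTerm_incl_of_ne {m l n : ℕ+} (h : m * l ≠ n) (a : CF n) :
    deltaTerm (m, l) (incl n a) = 0 :=
  comulTerm_single_of_ne (A := fun n : ℕ+ => CF n) phiPNat (q := (m, l)) h a

theorem deltaTerm_incl (m l : ℕ+) (a : CF (m * l : ℕ+)) :
    deltaTerm (m, l) (incl (m * l) a) = MinTensor.map (incl m) (incl l) (phiPNat m l a) :=
  comulTerm_single (A := fun n : ℕ+ => CF n) phiPNat m l a

/-- The equation `n = ml` is a hypothesis because one fixed `n` is factored in many ways; `Fin.cast`
transports the generators. -/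
theorem deltaTerm_incl_u {m l n : ℕ+} (h : (n : ℕ) = m * l) (g : FreeGroup (Fin n)) :
    deltaTerm (m, l) (incl n (GroupCStar.u g)) =
      MinTensor.tmul
        (incl m (GroupCStar.u (phiGroup m l (FreeGroup.map (Fin.cast h) g)).1))
        (incl l (GroupCStar.u (phiGroup m l (FreeGroup.map (Fin.cast h) g)).2)) := by
  obtain rfl : n = m * l := PNat.eq h
  have hg : FreeGroup.map (Fin.cast h) g = g := FreeGroup.map.id g
  rw [hg, deltaTerm_incl, phiPNat_u, MinTensor.map_tmul]

/-! ### Density -/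

/-- The `(m, l)`-component of the comultiplied unit is the unit of `C*(𝔽_m) ⊗ C*(𝔽_l)`, and every
other component is orthogonal to that block. -/
theorem deltaPhi_mul_tmul_incl (m l : ℕ+) (b : CF m) (c : CF l) :
    deltaPhi (incl (m * l) (GroupCStar.u 1)) * MinTensor.tmul (incl m b) (incl l c) =
      MinTensor.tmul (incl m b) (incl l c) := by
  refine ((deltaPhi_hasSum _).mul_right _).unique ?_
  convert hasSum_single (m, l) fun q hq => ?_ using 1
  · rw [deltaTerm_incl_u rfl, MinTensor.tmul_mul_tmul, ← map_mul, ← map_mul]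
    simp only [map_one, Prod.fst_one, Prod.snd_one, GroupCStar.u_one_mul]
  · rw [← MinTensor.map_tmul]
    exact map_single_mul_map_single (A := fun n : ℕ+ => CF n) hq _ _

theorem deltaPhi_dense : closure (Submodule.span ℂ
    {x | ∃ a b c : FreeSum, x = deltaPhi a * MinTensor.tmul b c} :
      Set (MinTensor FreeSum FreeSum)) = Set.univ := by
  rw [← Submodule.topologicalClosure_coe, Set.eq_univ_iff_forall]
  set V := (Submodule.span ℂ
    {x | ∃ a b c : FreeSum, x = deltaPhi a * MinTensor.tmul b c}).topologicalClosure
  have hV : IsClosed (V : Set (MinTensor FreeSum FreeSum)) :=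
    Submodule.isClosed_topologicalClosure _
  refine MinTensor.induction_tmul (P := fun x => x ∈ V) hV (fun _ _ => V.add_mem) fun b c => ?_
  -- Each leg in turn is approximated by sums of elements of the summands.
  refine FreeSum.induction (P := fun b => MinTensor.tmul b c ∈ V)
    (hV.preimage (MinTensor.continuous_tmul_left c)) ?_ (fun b b' hb hb' => ?_)
    (fun m b => ?_) b
  · rw [MinTensor.zero_tmul]; exact V.zero_mem
  · rw [MinTensor.add_tmul]; exact V.add_mem hb hb'
  refine FreeSum.induction (P := fun c => MinTensor.tmul (incl m b) c ∈ V)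
    (hV.preimage (MinTensor.continuous_tmul_right _)) ?_ (fun c c' hc hc' => ?_)
    (fun l c => ?_) c
  · rw [MinTensor.tmul_zero]; exact V.zero_mem
  · rw [MinTensor.tmul_add]; exact V.add_mem hc hc'
  · refine Submodule.le_topologicalClosure _ (Submodule.subset_span ?_)
    exact ⟨_, _, _, (deltaPhi_mul_tmul_incl m l b c).symm⟩

/-! ### Coassociativity -/

/-- The homomorphism `𝔽_{abc} → 𝔽_a × 𝔽_b × 𝔽_c` with `g_{(ib+j)c+k} ↦ (g_i, g_j, g_k)`. -/
def phiGroup₃ (a b c : ℕ) {n : ℕ} (h : n = a * b * c) :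
    FreeGroup (Fin n) →* FreeGroup (Fin a) × FreeGroup (Fin b) × FreeGroup (Fin c) :=
  FreeGroup.lift fun k =>
    (FreeGroup.of (Fin.cast h k).divNat.divNat, FreeGroup.of (Fin.cast h k).divNat.modNat,
      FreeGroup.of (Fin.cast h k).modNat)

theorem phiGroup_phiGroup_left {a b c n : ℕ} (h : n = a * b * c) (g : FreeGroup (Fin n)) :
    phiGroup₃ a b c h g =
      ((phiGroup a b (phiGroup (a * b) c (FreeGroup.map (Fin.cast h) g)).1).1,
        (phiGroup a b (phiGroup (a * b) c (FreeGroup.map (Fin.cast h) g)).1).2,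
        (phiGroup (a * b) c (FreeGroup.map (Fin.cast h) g)).2) := by
  induction g using FreeGroup.induction_on with
  | C1 => simp only [map_one, Prod.fst_one, Prod.snd_one]; rfl
  | of k => simp [phiGroup₃, phiGroup]
  | inv_of k hk => simp only [map_inv, hk, Prod.fst_inv, Prod.snd_inv]; rfl
  | mul x y hx hy => simp only [map_mul, hx, hy, Prod.fst_mul, Prod.snd_mul]; rfl

theorem phiGroup_phiGroup_right {a b c n : ℕ} (h : n = a * b * c) (h' : n = a * (b * c))
    (g : FreeGroup (Fin n)) :
    phiGroup₃ a b c h g =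
      ((phiGroup a (b * c) (FreeGroup.map (Fin.cast h') g)).1,
        (phiGroup b c (phiGroup a (b * c) (FreeGroup.map (Fin.cast h') g)).2).1,
        (phiGroup b c (phiGroup a (b * c) (FreeGroup.map (Fin.cast h') g)).2).2) := by
  induction g using FreeGroup.induction_on with
  | C1 => simp only [map_one, Prod.fst_one, Prod.snd_one]; rfl
  | of k =>
    simp only [phiGroup₃, phiGroup, FreeGroup.lift_apply_of, FreeGroup.map.of,
      finProdFinEquiv_symm_apply, Prod.mk.injEq, FreeGroup.of_injective.eq_iff]
    refine ⟨?_, ?_, ?_⟩ <;> apply Fin.ext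
    -- The three digits agree: `k / c / b = k / (bc)`, `(k / c) % b = (k % (bc)) / c` and `k % c =
    -- (k % (bc)) % c`.
    · simp [Fin.divNat, Nat.div_div_eq_div_mul, mul_comm]
    · simp [Fin.divNat, Fin.modNat, mul_comm b c, Nat.mod_mul_right_div_self]
    · simp [Fin.modNat]
  | inv_of k hk => simp only [map_inv, hk, Prod.fst_inv, Prod.snd_inv]; rfl
  | mul x y hx hy => simp only [map_mul, hx, hy, Prod.fst_mul, Prod.snd_mul]; rfl

section Coassoc

variable {n : ℕ+} (g : FreeGroup (Fin n))

/-- The `(a, b, c)`-component of `(Δ_φ ⊗ id) Δ_φ (g)` for `g ∈ 𝔽_n`. -/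
def coassocTermLeft (a b c : ℕ+) : MinTensor (MinTensor FreeSum FreeSum) FreeSum :=
  if h : (n : ℕ) = a * b * c then
    MinTensor.tmul
      (MinTensor.tmul
        (incl a (GroupCStar.u (phiGroup₃ a b c h g).1))
        (incl b (GroupCStar.u (phiGroup₃ a b c h g).2.1)))
      (incl c (GroupCStar.u (phiGroup₃ a b c h g).2.2))
  else 0

/-- The `(a, b, c)`-component of `(id ⊗ Δ_φ) Δ_φ (g)` for `g ∈ 𝔽_n`. -/
def coassocTermRight (a b c : ℕ+) : MinTensor FreeSum (MinTensor FreeSum FreeSum) :=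
  if h : (n : ℕ) = a * b * c then
    MinTensor.tmul
      (incl a (GroupCStar.u (phiGroup₃ a b c h g).1))
      (MinTensor.tmul
        (incl b (GroupCStar.u (phiGroup₃ a b c h g).2.1))
        (incl c (GroupCStar.u (phiGroup₃ a b c h g).2.2)))
  else 0

variable {g} in
-- The second comultiplication splits the leg of rank `d`, which gives zero unless `d = ab`.
-- Factorisations with `abc ≠ n` contribute the default value zero, so no side condition is needed.
theorem map_deltaTerm_id_deltaTerm {a b c d : ℕ+} :
    MinTensor.map (deltaTerm (a, b)) (NonUnitalStarAlgHom.id ℂ FreeSum)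
        (deltaTerm (d, c) (incl n (GroupCStar.u g))) =
      if d = a * b then coassocTermLeft g a b c else 0 := by
  by_cases h : (n : ℕ) = d * c
  · rw [deltaTerm_incl_u h, MinTensor.map_tmul]
    split_ifs with hd
    · subst hd
      have h' : (n : ℕ) = a * b * c := h
      rw [coassocTermLeft, dif_pos h', deltaTerm_incl_u (PNat.mul_coe a b),
        phiGroup_phiGroup_left]
      have hg (x : FreeGroup (Fin (a * b : ℕ+))) :
        FreeGroup.map (Fin.cast (PNat.mul_coe a b)) x = x := FreeGroup.map.id x
      rw [hg]
      rfl
    · rw [deltaTerm_incl_of_ne (Ne.symm hd), MinTensor.zero_tmul]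
  · rw [deltaTerm_incl_of_ne fun e => h (by rw [← e, PNat.mul_coe]), map_zero]
    split_ifs with hd
    · subst hd
      rw [coassocTermLeft, dif_neg fun e => h (by rw [e, PNat.mul_coe])]
    · rfl

variable {g} in
theorem map_id_deltaTerm_deltaTerm {a b c d : ℕ+} :
    MinTensor.map (NonUnitalStarAlgHom.id ℂ FreeSum) (deltaTerm (b, c))
        (deltaTerm (a, d) (incl n (GroupCStar.u g))) =
      if d = b * c then coassocTermRight g a b c else 0 := by
  by_cases h : (n : ℕ) = a * d
  · rw [deltaTerm_incl_u h, MinTensor.map_tmul]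
    split_ifs with hd
    · subst hd
      have h' : (n : ℕ) = a * b * c := by rw [h, PNat.mul_coe, mul_assoc]
      rw [coassocTermRight, dif_pos h', deltaTerm_incl_u (PNat.mul_coe b c),
        phiGroup_phiGroup_right h' h]
      have hg (x : FreeGroup (Fin (b * c : ℕ+))) :
        FreeGroup.map (Fin.cast (PNat.mul_coe b c)) x = x := FreeGroup.map.id x
      rw [hg]
      rfl
    · rw [deltaTerm_incl_of_ne (Ne.symm hd), MinTensor.tmul_zero]
  · rw [deltaTerm_incl_of_ne fun e => h (by rw [← e, PNat.mul_coe]), map_zero]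
    split_ifs with hd
    · subst hd
      rw [coassocTermRight, dif_neg fun e => h (by rw [e, PNat.mul_coe, mul_assoc])]
    · rfl

theorem mem_Icc_of_dvd {d m n : ℕ+} (hm : m ≤ n) (h : d ∣ m) : d ∈ Finset.Icc 1 n :=
  Finset.mem_Icc.mpr ⟨one_le, (PNat.le_of_dvd h).trans hm⟩

variable {g} in
-- The bound `d ≤ n` puts every divisor of `d` into the box `[1, n]`, over which all the sums range.
theorem map_deltaPhi_id_deltaTerm {d c : ℕ+} (hd : d ≤ n) :
    MinTensor.map deltaPhi (NonUnitalStarAlgHom.id ℂ FreeSum)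
        (deltaTerm (d, c) (incl n (GroupCStar.u g))) =
      ∑ q ∈ Finset.Icc 1 n ×ˢ Finset.Icc 1 n,
        if d = q.1 * q.2 then coassocTermLeft g q.1 q.2 c else 0 := by
  rw [← Finset.sum_congr rfl fun q _ => map_deltaTerm_id_deltaTerm (d := d)]
  by_cases h : (n : ℕ) = d * c
  · rw [deltaTerm_incl_u h, MinTensor.map_tmul,
      deltaPhi_incl (s := Finset.Icc 1 n) fun e he => mem_Icc_of_dvd hd he]
    simp only [MinTensor.map_tmul]
    -- Tensoring with the fixed right leg is additive, so it passes through the finite sum.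
    exact map_sum (AddMonoidHom.mk' (fun x : MinTensor FreeSum FreeSum => MinTensor.tmul x _)
      fun x y => MinTensor.add_tmul x y _) _ _
  · rw [deltaTerm_incl_of_ne fun e => h (by rw [← e, PNat.mul_coe])]
    simp only [map_zero, Finset.sum_const_zero]

variable {g} in
theorem map_id_deltaPhi_deltaTerm {a d : ℕ+} (hd : d ≤ n) :
    MinTensor.map (NonUnitalStarAlgHom.id ℂ FreeSum) deltaPhi
        (deltaTerm (a, d) (incl n (GroupCStar.u g))) =
      ∑ q ∈ Finset.Icc 1 n ×ˢ Finset.Icc 1 n,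
        if d = q.1 * q.2 then coassocTermRight g a q.1 q.2 else 0 := by
  rw [← Finset.sum_congr rfl fun q _ => map_id_deltaTerm_deltaTerm (d := d)]
  by_cases h : (n : ℕ) = a * d
  · rw [deltaTerm_incl_u h, MinTensor.map_tmul,
      deltaPhi_incl (s := Finset.Icc 1 n) fun e he => mem_Icc_of_dvd hd he]
    simp only [MinTensor.map_tmul]
    exact map_sum (AddMonoidHom.mk' (fun x : MinTensor FreeSum FreeSum => MinTensor.tmul _ x)
      fun x y => MinTensor.tmul_add _ x y) _ _
  · rw [deltaTerm_incl_of_ne fun e => h (by rw [← e, PNat.mul_coe])]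
    simp only [map_zero, Finset.sum_const_zero]

theorem map_deltaPhi_id_deltaPhi :
    MinTensor.map deltaPhi (NonUnitalStarAlgHom.id ℂ FreeSum)
        (deltaPhi (incl n (GroupCStar.u g))) =
      ∑ a ∈ Finset.Icc 1 n, ∑ b ∈ Finset.Icc 1 n, ∑ c ∈ Finset.Icc 1 n,
        coassocTermLeft g a b c := by
  rw [deltaPhi_incl (s := Finset.Icc 1 n) fun e he => mem_Icc_of_dvd le_rfl he, map_sum,
    Finset.sum_product_right,
    ← Finset.sum_product' (f := fun a b => ∑ c ∈ Finset.Icc 1 n, coassocTermLeft g a b c),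
    Finset.sum_comm (s := Finset.Icc 1 n ×ˢ Finset.Icc 1 n)]
  refine Finset.sum_congr rfl fun c _ => ?_
  refine (Finset.sum_congr rfl fun d hd =>
    map_deltaPhi_id_deltaTerm (Finset.mem_Icc.mp hd).2).trans ?_
  rw [Finset.sum_comm]
  refine Finset.sum_congr rfl fun q _ => ?_
  -- The sum over `d` keeps only `d = ab`. If `ab` lies outside the box, it does not divide `n`, and
  -- the term vanishes by its default value.
  rw [Finset.sum_ite_eq']
  refine ite_eq_left_iff.mpr fun hq => ?_
  rw [coassocTermLeft, dif_neg fun e => hq (mem_Icc_of_dvd le_rfl ⟨c, PNat.eq ?_⟩)]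
  rw [e, PNat.mul_coe, PNat.mul_coe]

theorem map_id_deltaPhi_deltaPhi :
    MinTensor.map (NonUnitalStarAlgHom.id ℂ FreeSum) deltaPhi
        (deltaPhi (incl n (GroupCStar.u g))) =
      ∑ a ∈ Finset.Icc 1 n, ∑ b ∈ Finset.Icc 1 n, ∑ c ∈ Finset.Icc 1 n,
        coassocTermRight g a b c := by
  rw [deltaPhi_incl (s := Finset.Icc 1 n) fun e he => mem_Icc_of_dvd le_rfl he, map_sum,
    Finset.sum_product]
  refine Finset.sum_congr rfl fun a _ => ?_
  refine (Finset.sum_congr rfl fun d hd =>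
    map_id_deltaPhi_deltaTerm (Finset.mem_Icc.mp hd).2).trans ?_
  rw [Finset.sum_comm, ← Finset.sum_product' (f := fun b c => coassocTermRight g a b c)]
  refine Finset.sum_congr rfl fun q _ => ?_
  rw [Finset.sum_ite_eq']
  refine ite_eq_left_iff.mpr fun hq => ?_
  rw [coassocTermRight, dif_neg fun e => hq (mem_Icc_of_dvd le_rfl ⟨a, PNat.eq ?_⟩)]
  rw [e, PNat.mul_coe, PNat.mul_coe, mul_assoc, mul_comm]

end Coassoc

/-! ### The associativity relation is linear and closed -/

namespace MinTensor.AssocEq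

variable {A : Type u} [NonUnitalCStarAlgebra A] {u u' : MinTensor (MinTensor A A) A}
  {v v' : MinTensor A (MinTensor A A)}

theorem zero : AssocEq (0 : MinTensor (MinTensor A A) A) 0 := by
  intro H₁ H₂ H₃ _ _ _ _ _ _ _ _ _ π₁ π₂ π₃ x₁ y₁ x₂ y₂ x₃ y₃
  rw [map_zero, map_zero, zero_apply, zero_apply, inner_zero_right, inner_zero_right]

theorem add (h : AssocEq u v) (h' : AssocEq u' v') : AssocEq (u + u') (v + v') := by
  intro H₁ H₂ H₃ _ _ _ _ _ _ _ _ _ π₁ π₂ π₃ x₁ y₁ x₂ y₂ x₃ y₃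
  rw [map_add, map_add, add_apply, add_apply, inner_add_right, inner_add_right, h, h']

theorem smul (c : ℂ) (h : AssocEq u v) : AssocEq (c • u) (c • v) := by
  intro H₁ H₂ H₃ _ _ _ _ _ _ _ _ _ π₁ π₂ π₃ x₁ y₁ x₂ y₂ x₃ y₃
  rw [map_smul, map_smul, smul_apply, smul_apply, inner_smul_right, inner_smul_right, h]

theorem sum {κ : Type*} (s : Finset κ) {f : κ → MinTensor (MinTensor A A) A}
    {g : κ → MinTensor A (MinTensor A A)} (h : ∀ i ∈ s, AssocEq (f i) (g i)) :
    AssocEq (∑ i ∈ s, f i) (∑ i ∈ s, g i) := by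
  induction s using Finset.cons_induction with
  | empty => exact zero
  | cons i s hi ih =>
    rw [Finset.sum_cons, Finset.sum_cons]
    exact (h i (Finset.mem_cons_self i s)).add
      (ih fun j hj => h j (Finset.mem_cons_of_mem hj))

/-- Matrix coefficients of elementary tensors are products of three inner products, so this is
associativity of multiplication in `ℂ`. -/
theorem tmul (a b c : A) : AssocEq (MinTensor.tmul (MinTensor.tmul a b) c)
    (MinTensor.tmul a (MinTensor.tmul b c)) := by
  intro H₁ H₂ H₃ _ _ _ _ _ _ _ _ _ π₁ π₂ π₃ x₁ y₁ x₂ y₂ x₃ y₃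
  simp only [rep_tmul, hilbertTmul, opTensor_coe, TensorProduct.mapL_tmul, Completion.inner_coe,
    TensorProduct.inner_tmul, mul_assoc]

/-- For fixed representations and vectors both matrix coefficients are continuous, so each required
equality is a closed condition. -/
theorem isClosed_setOf {X : Type*} [TopologicalSpace X] {f : X → MinTensor (MinTensor A A) A}
    {g : X → MinTensor A (MinTensor A A)} (hf : Continuous f) (hg : Continuous g) :
    IsClosed {x | AssocEq (f x) (g x)} := by
  refine isClosed_of_closure_subset fun x hx => ?_
  intro H₁ H₂ H₃ _ _ _ _ _ _ _ _ _ π₁ π₂ π₃ x₁ y₁ x₂ y₂ x₃ y₃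
  have h1 : Continuous fun x => rep (rep π₁ π₂) π₃ (f x) :=
    (NonUnitalStarAlgHom.continuous_of_cstar _).comp hf
  have h2 : Continuous fun x => rep π₁ (rep π₂ π₃) (g x) :=
    (NonUnitalStarAlgHom.continuous_of_cstar _).comp hg
  refine closure_minimal (fun y hy => ?_) (isClosed_eq
    (continuous_const.inner (h1.clm_apply continuous_const))
    (continuous_const.inner (h2.clm_apply continuous_const))) hx
  exact hy H₁ H₂ H₃ π₁ π₂ π₃ x₁ y₁ x₂ y₂ x₃ y₃

end MinTensor.AssocEq

theorem assocEq_coassocTerm {n : ℕ+} (g : FreeGroup (Fin n)) (a b c : ℕ+) :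
    MinTensor.AssocEq (coassocTermLeft g a b c) (coassocTermRight g a b c) := by
  unfold coassocTermLeft coassocTermRight
  split_ifs
  · exact .tmul _ _ _
  · exact .zero

/-- The relation compares elements of two different algebras, so extensionality of homomorphisms
does not apply; its linearity and closedness take over the density argument. -/
theorem assocEq_of_incl_u {A : Type} [NonUnitalCStarAlgebra A]
    (F : FreeSum →⋆ₙₐ[ℂ] MinTensor (MinTensor A A) A)
    (G : FreeSum →⋆ₙₐ[ℂ] MinTensor A (MinTensor A A))
    (h : ∀ (n : ℕ+) (g : FreeGroup (Fin n)), MinTensor.AssocEq (F (incl n (GroupCStar.u g)))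
      (G (incl n (GroupCStar.u g)))) (x : FreeSum) : MinTensor.AssocEq (F x) (G x) := by
  have hc := MinTensor.AssocEq.isClosed_setOf F.continuous_of_cstar G.continuous_of_cstar
  refine FreeSum.induction hc ?_ (fun x y hx hy => ?_) (fun n a => ?_) x
  · rw [map_zero, map_zero]; exact .zero
  · rw [map_add, map_add]; exact hx.add hy
  refine GroupCStar.induction (hc.preimage (incl n).continuous_of_cstar) (fun x y hx hy => ?_)
    (fun z x hx => ?_) (h n) a
  · change MinTensor.AssocEq (F (incl n (x + y))) (G (incl n (x + y)))
    rw [map_add, map_add, map_add]; exact hx.add hy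
  · change MinTensor.AssocEq (F (incl n (z • x))) (G (incl n (z • x)))
    rw [map_smul, map_smul, map_smul]; exact hx.smul z

theorem deltaPhi_coassoc (x : FreeSum) : MinTensor.AssocEq
    (MinTensor.map deltaPhi (NonUnitalStarAlgHom.id ℂ FreeSum) (deltaPhi x))
    (MinTensor.map (NonUnitalStarAlgHom.id ℂ FreeSum) deltaPhi (deltaPhi x)) := by
  refine assocEq_of_incl_u
    ((MinTensor.map deltaPhi (NonUnitalStarAlgHom.id ℂ FreeSum)).comp deltaPhi)
    ((MinTensor.map (NonUnitalStarAlgHom.id ℂ FreeSum) deltaPhi).comp deltaPhi)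
    (fun n g => ?_) x
  rw [NonUnitalStarAlgHom.comp_apply, NonUnitalStarAlgHom.comp_apply,
    map_deltaPhi_id_deltaPhi, map_id_deltaPhi_deltaPhi]
  exact .sum _ fun a _ => .sum _ fun b _ => .sum _ fun c _ => assocEq_coassocTerm g a b c

theorem isCStarBialgebra_deltaPhi : IsCStarBialgebra deltaPhi :=
  ⟨deltaPhi_dense, deltaPhi_coassoc⟩

/-! ### Automorphisms -/

theorem IsCStarBialgebraAut.comp {A : Type u} [NonUnitalCStarAlgebra A]
    {Δ : A →⋆ₙₐ[ℂ] MinTensor A A} {f g : A →⋆ₙₐ[ℂ] A} (hf : IsCStarBialgebraAut Δ f)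
    (hg : IsCStarBialgebraAut Δ g) : IsCStarBialgebraAut Δ (f.comp g) where
  isCStarBialgebra := hf.isCStarBialgebra
  bijective := hf.bijective.comp hg.bijective
  nondegenerate := by
    rw [← hf.nondegenerate]
    -- Since `g` is surjective, the products `f (g a) * b` and `f a * b` run over the same set.
    congr 4 with x
    constructor
    · rintro ⟨a, b, rfl⟩; exact ⟨g a, b, rfl⟩
    · rintro ⟨a, b, rfl⟩
      obtain ⟨a, rfl⟩ := hg.bijective.surjective a
      exact ⟨a, b, rfl⟩
  map_comul := by
    ext x
    have h1 := DFunLike.congr_fun hg.map_comul x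
    have h2 := DFunLike.congr_fun hf.map_comul (g x)
    simp only [NonUnitalStarAlgHom.comp_apply] at h1 h2 ⊢
    rw [← MinTensor.map_map, h1, h2]

/-- Some `a` is mapped to the unit of the `n`-th summand, so each element of that summand is itself
a product `f a * b`. -/
theorem span_mul_dense {f : FreeSum →⋆ₙₐ[ℂ] FreeSum} (hf : Function.Surjective f) :
    closure (Submodule.span ℂ {x | ∃ a b : FreeSum, x = f a * b} : Set FreeSum) = Set.univ := by
  rw [← Submodule.topologicalClosure_coe, Set.eq_univ_iff_forall]
  set V := (Submodule.span ℂ {x | ∃ a b : FreeSum, x = f a * b}).topologicalClosure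
  refine FreeSum.induction (P := fun x => x ∈ V) (Submodule.isClosed_topologicalClosure _)
    V.zero_mem (fun _ _ => V.add_mem) fun n x => ?_
  obtain ⟨a, ha⟩ := hf (incl n (GroupCStar.u 1))
  refine Submodule.le_topologicalClosure _ (Submodule.subset_span ⟨a, incl n x, ?_⟩)
  rw [ha, ← map_mul, GroupCStar.u_one_mul]

theorem isCStarBialgebraAut_map {f : ∀ n : ℕ+, CF n →⋆ₙₐ[ℂ] CF n}
    (hf : Function.Bijective (C0Sum.map (A := fun n : ℕ+ => CF n) f))
    (h : ∀ m l : ℕ+, (MinTensor.map (f m) (f l)).comp (phiPNat m l) =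
      (phiPNat m l).comp (f (m * l))) :
    IsCStarBialgebraAut deltaPhi (C0Sum.map (A := fun n : ℕ+ => CF n) f) where
  isCStarBialgebra := isCStarBialgebra_deltaPhi
  bijective := hf
  nondegenerate := span_mul_dense hf.surjective
  map_comul := map_comul_of_intertwines (A := fun n : ℕ+ => CF n) phiPNat f h

/-- ⋆-homomorphisms out of `C*(𝔽_n)` that agree on the generators are equal. -/
theorem CF.hom_ext {n : ℕ+} {T : Type*} [NonUnitalCStarAlgebra T] {f f' : CF n →⋆ₙₐ[ℂ] T}
    (h : ∀ i, f (gen n i) = f' (gen n i)) : f = f' := by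
  refine GroupCStar.hom_ext fun g => ?_
  induction g using FreeGroup.induction_on with
  | C1 =>
    -- The homomorphisms are not assumed unital, so agreement at the unit needs an argument: it is
    -- `g⋆ g` for a generator `g`, which exists because `n ≥ 1`.
    have h1 : GroupCStar.u (1 : FreeGroup (Fin n)) = star (gen n ⟨0, n.pos⟩) * gen n ⟨0, n.pos⟩ := by
      rw [gen, ← GroupCStar.u_inv, ← GroupCStar.u_mul, inv_mul_cancel]
    rw [h1, map_mul, map_mul, map_star, map_star, h]
  | of i => exact h i
  | inv_of i hi => rw [GroupCStar.u_inv, map_star, map_star, hi]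
  | mul x y hx hy => rw [GroupCStar.u_mul, map_mul, map_mul, hx, hy]

/-! ### Values on generators and the group laws -/

theorem alphaN_u (t : ℝ) (n : ℕ) (g : FreeGroup (Fin n)) :
    alphaN t n (GroupCStar.u g) = (alphaChar t n g : ℂ) • GroupCStar.u g :=
  GroupCStar.lift_u _ _ _ g

theorem betaN_u (n : ℕ) (g : FreeGroup (Fin n)) :
    betaN n (GroupCStar.u g) = GroupCStar.u (FreeGroup.map Fin.rev g) :=
  GroupCStar.lift_u _ _ _ g

theorem alphaN_gen (t : ℝ) (n : ℕ) (i : Fin n) :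
    alphaN t n (gen n i) = Complex.exp (Complex.I * t * Real.log n) • gen n i := by
  rw [gen, alphaN_u, alphaChar, FreeGroup.lift_apply_of, Circle.coe_exp]
  congr 2
  push_cast
  ring

theorem betaN_gen (n : ℕ) (i : Fin n) : betaN n (gen n i) = gen n i.rev := by
  rw [gen, betaN_u, FreeGroup.map.of, gen]

theorem alphaN_comp (t s : ℝ) (n : ℕ+) :
    (alphaN t n).comp (alphaN s n) = alphaN (t + s) n := by
  refine CF.hom_ext fun i => ?_
  rw [NonUnitalStarAlgHom.comp_apply, alphaN_gen, map_smul, alphaN_gen, alphaN_gen, smul_smul,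
    ← Complex.exp_add]
  congr 2
  push_cast
  ring

theorem alphaN_zero (n : ℕ+) : alphaN 0 n = NonUnitalStarAlgHom.id ℂ (CF n) := by
  refine CF.hom_ext fun i => ?_
  rw [alphaN_gen]
  simp

theorem betaN_comp_betaN (n : ℕ+) : (betaN n).comp (betaN n) = NonUnitalStarAlgHom.id ℂ (CF n) := by
  refine CF.hom_ext fun i => ?_
  rw [NonUnitalStarAlgHom.comp_apply, betaN_gen, betaN_gen, Fin.rev_rev]
  rfl

theorem alphaN_comp_betaN (t : ℝ) (n : ℕ+) :
    (alphaN t n).comp (betaN n) = (betaN n).comp (alphaN t n) := by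
  refine CF.hom_ext fun i => ?_
  rw [NonUnitalStarAlgHom.comp_apply, NonUnitalStarAlgHom.comp_apply, betaN_gen, alphaN_gen,
    alphaN_gen, map_smul, betaN_gen]

theorem alpha_comp (t s : ℝ) : (alpha t).comp (alpha s) = alpha (t + s) :=
  congrArg (C0Sum.map (A := fun n : ℕ+ => CF n) (B := fun n : ℕ+ => CF n))
    (funext fun n => alphaN_comp t s n)

theorem alpha_zero : alpha 0 = NonUnitalStarAlgHom.id ℂ FreeSum :=
  congrArg (C0Sum.map (A := fun n : ℕ+ => CF n) (B := fun n : ℕ+ => CF n))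
    (funext fun n => alphaN_zero n)

theorem beta_comp_beta : beta.comp beta = NonUnitalStarAlgHom.id ℂ FreeSum :=
  congrArg (C0Sum.map (A := fun n : ℕ+ => CF n) (B := fun n : ℕ+ => CF n))
    (funext fun n => betaN_comp_betaN n)

theorem alpha_comp_beta (t : ℝ) : (alpha t).comp beta = beta.comp (alpha t) :=
  congrArg (C0Sum.map (A := fun n : ℕ+ => CF n) (B := fun n : ℕ+ => CF n))
    (funext fun n => alphaN_comp_betaN t n)

theorem bijective_of_comp_eq_id {A : Type*} [NonUnitalCStarAlgebra A] {f g : A →⋆ₙₐ[ℂ] A}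
    (h : f.comp g = NonUnitalStarAlgHom.id ℂ A) (h' : g.comp f = NonUnitalStarAlgHom.id ℂ A) :
    Function.Bijective f :=
  Function.bijective_iff_has_inverse.mpr ⟨g, DFunLike.congr_fun h', DFunLike.congr_fun h⟩

theorem alphaN_bijective (t : ℝ) (n : ℕ+) : Function.Bijective (alphaN t n) :=
  bijective_of_comp_eq_id (g := alphaN (-t) n)
    (by rw [alphaN_comp, add_neg_cancel, alphaN_zero])
    (by rw [alphaN_comp, neg_add_cancel, alphaN_zero])

theorem alpha_bijective (t : ℝ) : Function.Bijective (alpha t) :=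
  bijective_of_comp_eq_id (g := alpha (-t))
    (by rw [alpha_comp, add_neg_cancel, alpha_zero])
    (by rw [alpha_comp, neg_add_cancel, alpha_zero])

/-! ### Intertwining with `φ_{m,l}` -/

theorem phi_gen (n m : ℕ) (k : Fin (n * m)) :
    phi n m (gen (n * m) k) = MinTensor.tmul (gen n k.divNat) (gen m k.modNat) := by
  have h : phiGroup n m (FreeGroup.of k) = (FreeGroup.of k.divNat, FreeGroup.of k.modNat) :=
    FreeGroup.lift_apply_of
  rw [gen, phi, GroupCStar.lift_u, h, gen, gen]

theorem phiPNat_gen (m l : ℕ+) (k : Fin (m * l : ℕ+)) :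
    phiPNat m l (gen (m * l : ℕ+) k) =
      MinTensor.tmul (gen m (Fin.cast (PNat.mul_coe m l) k).divNat)
        (gen l (Fin.cast (PNat.mul_coe m l) k).modNat) :=
  phi_gen m l k

theorem isCStarBialgebraAut_alpha (t : ℝ) : IsCStarBialgebraAut deltaPhi (alpha t) := by
  refine isCStarBialgebraAut_map (alpha_bijective t) fun m l => CF.hom_ext fun k => ?_
  -- Additivity of the logarithm is what makes the phases compatible with `φ_{m,l}`.
  have hlog : Real.log (m * l : ℕ+) = Real.log m + Real.log l := by
    rw [PNat.mul_coe, Nat.cast_mul, Real.log_mul (Nat.cast_ne_zero.mpr m.ne_zero)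
      (Nat.cast_ne_zero.mpr l.ne_zero)]
  rw [NonUnitalStarAlgHom.comp_apply, NonUnitalStarAlgHom.comp_apply, alphaN_gen, map_smul,
    phiPNat_gen, MinTensor.map_tmul, alphaN_gen, alphaN_gen, MinTensor.smul_tmul,
    MinTensor.tmul_smul, smul_smul, ← Complex.exp_add, hlog]
  congr 2
  push_cast
  ring

/-- With zero-based indices, `ml - 1 - (il + j) = (m - 1 - i) l + (l - 1 - j)`, where the last
summand is again a remainder below `l`. -/
theorem Fin.divNat_rev {m l : ℕ} (k : Fin (m * l)) : k.rev.divNat = k.divNat.rev := by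
  obtain ⟨⟨i, j⟩, rfl⟩ := finProdFinEquiv.surjective k
  suffices h : (finProdFinEquiv (i, j)).rev = finProdFinEquiv (i.rev, j.rev) by
    have hd (p : Fin m × Fin l) : (finProdFinEquiv p).divNat = p.1 :=
      congrArg Prod.fst (finProdFinEquiv.symm_apply_apply p)
    rw [h, hd, hd]
  apply Fin.ext
  simp only [Fin.val_rev, finProdFinEquiv_apply_val]
  obtain ⟨i, hi⟩ := i
  obtain ⟨j, hj⟩ := j
  -- Writing `m = i + p + 1` and `l = j + q + 1` makes `p` and `q` the reversed digits and removes
  -- the truncated subtractions.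
  obtain ⟨p, rfl⟩ := Nat.exists_eq_add_of_lt hi
  obtain ⟨q, rfl⟩ := Nat.exists_eq_add_of_lt hj
  have h1 : i + p + 1 - (i + 1) = p := by omega
  have h2 : j + q + 1 - (j + 1) = q := by omega
  simp only [h1, h2]
  refine Nat.sub_eq_of_eq_add ?_
  ring

theorem isCStarBialgebraAut_beta : IsCStarBialgebraAut deltaPhi beta := by
  refine isCStarBialgebraAut_map (bijective_of_comp_eq_id beta_comp_beta beta_comp_beta)
    fun m l => CF.hom_ext fun k => ?_
  rw [NonUnitalStarAlgHom.comp_apply, NonUnitalStarAlgHom.comp_apply, betaN_gen,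
    phiPNat_gen, phiPNat_gen, MinTensor.map_tmul, betaN_gen, betaN_gen]
  rw [Fin.cast_rev, Fin.divNat_rev, Fin.modNat_rev]

/-! ### The action of `ℝ × ℤ/2ℤ` -/

/-- `α_t^{(*)}` as a ⋆-automorphism. -/
def alphaEquiv (t : ℝ) : FreeSum ≃⋆ₐ[ℂ] FreeSum :=
  StarAlgEquiv.ofBijective (alpha t) (alpha_bijective t)

/-- `β^{(*)}` as a ⋆-automorphism. -/
def betaEquiv : FreeSum ≃⋆ₐ[ℂ] FreeSum :=
  StarAlgEquiv.ofBijective beta isCStarBialgebraAut_beta.bijective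

theorem betaEquiv_sq : betaEquiv * betaEquiv = 1 :=
  StarAlgEquiv.ext fun x => DFunLike.congr_fun beta_comp_beta x

theorem alphaEquiv_mul (t s : ℝ) : alphaEquiv t * alphaEquiv s = alphaEquiv (t + s) :=
  StarAlgEquiv.ext fun x => DFunLike.congr_fun (alpha_comp t s) x

theorem alphaEquiv_zero : alphaEquiv 0 = 1 :=
  StarAlgEquiv.ext fun x => DFunLike.congr_fun alpha_zero x

theorem alphaEquiv_commute_betaEquiv (t : ℝ) : Commute (alphaEquiv t) betaEquiv :=
  StarAlgEquiv.ext fun x => DFunLike.congr_fun (alpha_comp_beta t) x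

/-- Representatives in `{0, 1}` add only modulo `2`; the relation `b * b = 1` absorbs the carry. -/
theorem pow_val_add {M : Type*} [Monoid M] {b : M} (hb : b * b = 1) (i j : ZMod 2) :
    b ^ (i + j).val = b ^ i.val * b ^ j.val := by
  rw [← pow_add, ZMod.val_add]
  exact (pow_eq_pow_mod (i.val + j.val) ((sq b).trans hb)).symm

/-- The action of `ℝ × ℤ/2ℤ` by `(t, i) ↦ α_t^{(*)} (β^{(*)})^i`. -/
def alphaBeta : Multiplicative (ℝ × ZMod 2) →* (FreeSum ≃⋆ₐ[ℂ] FreeSum) where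
  toFun g := alphaEquiv g.toAdd.1 * betaEquiv ^ g.toAdd.2.val
  map_one' := by
    rw [toAdd_one, Prod.fst_zero, Prod.snd_zero, ZMod.val_zero, pow_zero, alphaEquiv_zero, mul_one]
  map_mul' g h := by
    rw [toAdd_mul, Prod.fst_add, Prod.snd_add, pow_val_add betaEquiv_sq, ← alphaEquiv_mul,
      mul_assoc, mul_assoc, ← mul_assoc (alphaEquiv h.toAdd.1),
      ((alphaEquiv_commute_betaEquiv h.toAdd.1).pow_right g.toAdd.2.val).eq, mul_assoc]

theorem alphaBeta_apply_zero (t : ℝ) : alphaBeta (.ofAdd (t, 0)) = alphaEquiv t := by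
  change alphaEquiv t * betaEquiv ^ (0 : ZMod 2).val = _
  rw [ZMod.val_zero, pow_zero, mul_one]

theorem alphaBeta_apply_one (t : ℝ) :
    alphaBeta (.ofAdd (t, 1)) = alphaEquiv t * betaEquiv := by
  change alphaEquiv t * betaEquiv ^ (1 : ZMod 2).val = _
  rw [ZMod.val_one, pow_one]

theorem isCStarBialgebraAut_alphaBeta (g : Multiplicative (ℝ × ZMod 2)) :
    IsCStarBialgebraAut deltaPhi (alphaBeta g : FreeSum →⋆ₙₐ[ℂ] FreeSum) := by
  obtain ⟨t, i⟩ := g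
  -- The action consists only of the maps `α_t` and `α_t ∘ β`.
  obtain rfl | rfl : i = 0 ∨ i = 1 := by revert i; decide
  · have h : (alphaBeta (.ofAdd (t, 0)) : FreeSum →⋆ₙₐ[ℂ] FreeSum) = alpha t := by
      rw [alphaBeta_apply_zero]; rfl
    exact h ▸ isCStarBialgebraAut_alpha t
  · have h : (alphaBeta (.ofAdd (t, 1)) : FreeSum →⋆ₙₐ[ℂ] FreeSum) = (alpha t).comp beta := by
      rw [alphaBeta_apply_one]; rfl
    exact h ▸ (isCStarBialgebraAut_alpha t).comp isCStarBialgebraAut_beta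

end
-- The main theorem
theorem mainTheorem6 :
    (∀ (t : ℝ) (n : ℕ+), Function.Bijective (alphaN t n) ∧
      (∀ i, alphaN t n (gen n i) = Complex.exp (Complex.I * t * Real.log n) • gen n i) ∧
      ∀ f : CF n ≃⋆ₐ[ℂ] CF n,
        (∀ i, f (gen n i) = Complex.exp (Complex.I * t * Real.log n) • gen n i) →
          ∀ x, f x = alphaN t n x) ∧
    (∀ n : ℕ+, Function.Bijective (betaN n) ∧
      (∀ i, betaN n (gen n i) = gen n i.rev) ∧
      ∀ f : CF n ≃⋆ₐ[ℂ] CF n, (∀ i, f (gen n i) = gen n i.rev) → ∀ x, f x = betaN n x) ∧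
    (∀ t, IsCStarBialgebraAut deltaPhi (alpha t)) ∧
    IsCStarBialgebraAut deltaPhi beta ∧
    (∀ t s, (alpha t).comp (alpha s) = alpha (t + s)) ∧
    beta.comp beta = NonUnitalStarAlgHom.id ℂ FreeSum ∧
    (∀ t, (alpha t).comp beta = beta.comp (alpha t)) ∧
    ∃ Φ : Multiplicative (ℝ × ZMod 2) →* (FreeSum ≃⋆ₐ[ℂ] FreeSum),
      (∀ g, IsCStarBialgebraAut deltaPhi (Φ g : FreeSum →⋆ₙₐ[ℂ] FreeSum)) ∧
      (∀ t x, Φ (Multiplicative.ofAdd (t, 0)) x = alpha t x) ∧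
      (∀ x, Φ (Multiplicative.ofAdd (0, 1)) x = beta x) := by
  refine ⟨fun t n => ⟨alphaN_bijective t n, alphaN_gen t n, fun f hf => ?_⟩,
    fun n => ⟨bijective_of_comp_eq_id (betaN_comp_betaN n) (betaN_comp_betaN n), betaN_gen n,
      fun f hf => ?_⟩,
    isCStarBialgebraAut_alpha, isCStarBialgebraAut_beta, alpha_comp, beta_comp_beta,
    alpha_comp_beta, alphaBeta, isCStarBialgebraAut_alphaBeta, fun t x => ?_, fun x => ?_⟩
  -- Uniqueness holds already among ⋆-homomorphisms, so the automorphism `f` is used only as one.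
  · exact DFunLike.congr_fun (CF.hom_ext (f := (f : CF n →⋆ₙₐ[ℂ] CF n)) (f' := alphaN t n)
      fun i => (hf i).trans (alphaN_gen t n i).symm)
  · exact DFunLike.congr_fun (CF.hom_ext (f := (f : CF n →⋆ₙₐ[ℂ] CF n)) (f' := betaN n)
      fun i => (hf i).trans (betaN_gen n i).symm)
  · rw [alphaBeta_apply_zero]; rfl
  · rw [alphaBeta_apply_one, alphaEquiv_zero, one_mul]; rfl
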